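/- **Setting.** Norms are Euclidean. Consider the plant $\dot x = Ax + Bu$ with $x\in\mathbb R^n$ (no unknown input, $v\equiv 0$), controller nodes $\iota=1,\dots,N_c$ with $Bu=\sum_{\iota=1}^{N_c}B^\iota u^\iota$, and observer nodes $i=1,\dots,N$. Node $i$ measures $y_i=C_ix\in\mathbb R^{p_i}$ ($C_i$ of full row rank) and receives a local input $u_i=\sum_\iota S_{i\iota}u^\iota$, a fixed linear portion of the control inputs (for instance those of the controller nodes linked to it); $Bu=B_iu_i+B_{-i}u_{-i}$ with $B_{-i}$ of full column rank and $u_{-i}$ not available to node $i$. The observer nodes exchange estimates over a connected undirected graph without self-loops, with symmetric weights $a_{ij}=a_{ji}$, positive on edges and zero otherwise. **Observer design.** Let $\Omega_i(\delta)$ be the set of quadruples $(T,E,F,G)$, $T\in\mathbb R^{n\times\delta}$, $E\in\mathbb R^{\delta\times\delta}$, $F,G\in\mathbb R^{\delta\times p_i}$, with $T^\top T=I_\delta$, $GC_iB_{-i}=T^\top B_{-i}$, $ET^\top+(GC_i-T^\top)A+(F-EG)C_i=0$, and either all eigenvalues of $E$ in the open left half-plane or $\delta=p_i$ and $E=0$.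 Let $\delta_i$ be the largest $\delta$ with $\Omega_i(\delta)\ne\emptyset$, and let $(T_{id},E_i,F_i,G_i)\in\Omega_i(\delta_i)$, where in the case $E_i=0$ the quadruple is chosen with $G_iC_i=T_{id}^\top$. Let $T_{iu}\in\mathbb R^{n\times(n-\delta_i)}$ satisfy $T_{id}^\top T_{iu}=0$, $T_{iu}^\top T_{iu}=I$, $T_{iu}T_{iu}^\top=I-T_{id}T_{id}^\top$. Put $\bar E_i=T_{id}E_iT_{id}^\top+T_{iu}T_{iu}^\top A$, $\bar G_i=T_{id}G_i$, $\bar F_i=T_{id}F_i+T_{iu}T_{iu}^\top A\bar G_i$, $\bar B_i=(I-\bar G_iC_i)B_i$. The observer nodes are $$\dot z_i=\bar E_iz_i+\bar F_iy_i+\bar B_iu_i-\gamma_iT_{iu}\varepsilon_{iu}-\gamma_{is}T_{iu}h(\varepsilon_{iu}),\qquad \hat x_i=z_i+\bar G_iy_i,\qquad z_i(0)=0,$$ $$\varepsilon_{iu}=T_{iu}^\top\sum_{j=1}^Na_{ij}(\hat x_i-\hat x_j),\qquad \dot\gamma_i=\phi_i\|\varepsilon_{iu}\|^2,\qquad \dot\gamma_{is}=\phi_{is}\|\varepsilon_{iu}\|,$$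 with $\phi_i,\phi_{is},\gamma_i(0),\gamma_{is}(0)>0$, where $h(\omega)=\omega/\|\omega\|$ for $\omega\neq0$ and $h(0)=0$. Solutions are absolutely continuous on compact subintervals of $[0,\infty)$ and satisfy the equations almost everywhere, the discontinuous term being understood in the sense of Filippov (at $\varepsilon_{iu}=0$ any vector of the closed unit ball is admitted as the value of $h$; in particular the value $0$). **Theorem.** Suppose that $(A,B)$ is stabilizable, that the gains $K^\iota$ stabilize the plant (every solution of $\dot x=Ax+\sum_\iota B^\iota K^\iota x$ tends to $0$), that the graph is connected, and that $\sum_{i=1}^N\operatorname{Im}T_{id}=\mathbb R^n$ (collective strong detectability). Let the reference signals $r^\iota:[0,\infty)\to\mathbb R^{m^\iota}$ be bounded, where $m^\iota$ is the dimension of $u^\iota$, let each controller node use the estimate of an arbitrary observer node $i'=i'(\iota)$ in $$u^\iota=K^\iota\hat x_{i'}+r^\iota,\qquad \iota=1,\dots,N_c,$$ and let $x_r$ be any solution of the reference system $\dot x_r=Ax_r+\sum_{\iota}B^\iota(K^\iota x_r+r^\iota)$. Then, for every solution of the closed loop on $[0,\infty)$ (with arbitrary $x(0)$ and $x_r(0)$),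 $\lim_{t\to\infty}\|x(t)-x_r(t)\|=0$; moreover, for every $i$, $\lim_{t\to\infty}\|\hat x_i(t)-x(t)\|=0$, and the adaptive gains $\gamma_i$ and $\gamma_{is}$ are bounded on $[0,\infty)$. -/

import Mathlib

open Filter Topology MeasureTheory

/-- Column vectors with `k` real entries; `‖·‖` is the Euclidean norm. -/
abbrev Vec (k : ℕ) := EuclideanSpace ℝ (Fin k)

/-- Real matrices with `k` rows and `l` columns. -/
abbrev Mat (k l : ℕ) := Matrix (Fin k) (Fin l) ℝ

/-- The product of a matrix and a column vector. -/
noncomputable def Mat.act {k l : ℕ} (M : Mat k l) (x : Vec l) : Vec k :=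
  WithLp.toLp 2 (Matrix.mulVec M x.ofLp)

/-- All (complex) eigenvalues of `M` lie in the open left half-plane. -/
def IsHurwitz {k : ℕ} (M : Mat k k) : Prop :=
  ∀ μ ∈ spectrum ℂ (M.map (fun a : ℝ => (a : ℂ))), μ.re < 0

/-- The pair `(A, B)` is stabilizable. -/
def IsStabilizable {n m : ℕ} (A : Mat n n) (B : Mat n m) : Prop :=
  ∃ K : Mat m n, IsHurwitz (A + B * K)

/-- `x` is (locally) absolutely continuous on `[0, ∞)` with derivative `f` almost everywhere:
the integral form of `dx/dt = f` used for equations with a discontinuous right-hand side. -/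
def HasVelocity {V : Type} [NormedAddCommGroup V] [NormedSpace ℝ V] (x f : ℝ → V) : Prop :=
  ∀ t : ℝ, 0 ≤ t → IntervalIntegrable f volume 0 t ∧ x t = x 0 + ∫ s in (0 : ℝ)..t, f s

/-- `x` is bounded on `[0, ∞)`. -/
def IsBoundedSignal {V : Type} [NormedAddCommGroup V] (x : ℝ → V) : Prop :=
  ∃ c : ℝ, ∀ t : ℝ, 0 ≤ t → ‖x t‖ ≤ c

/-- The unit-vector function: `ω / ‖ω‖` for `ω ≠ 0`, and `0` at `ω = 0`. -/
noncomputable def unitVec {k : ℕ} (ω : Vec k) : Vec k := by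
  classical exact if ω = 0 then 0 else ‖ω‖⁻¹ • ω

/-- The set-valued (Filippov) regularization of `unitVec`: the value `unitVec ω` where this
function is continuous, and the closed unit ball at the discontinuity `ω = 0`. -/
def unitVecSet {k : ℕ} (ω : Vec k) : Set (Vec k) :=
  {η | (ω ≠ 0 → η = unitVec ω) ∧ ‖η‖ ≤ 1}

/-- `unitVec` is a selection of `unitVecSet`, so solutions in the ordinary sense (with the value
`0` at `0`) are solutions in the regularized sense. -/
theorem unitVec_mem_unitVecSet {k : ℕ} (ω : Vec k) : unitVec ω ∈ unitVecSet ω := by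
  refine ⟨fun _ => rfl, ?_⟩
  unfold unitVec
  by_cases h : ω = 0
  · simp [h]
  · simp [h, norm_smul]

/-! ### Plant, controller channels, observer nodes -/

/-- The plant `dx/dt = A x + B u`, and the input matrices `Bc ι` (with `b ι` columns) of the
channels of the controller nodes `ι = 1, …, Nc`. -/
structure Plant (n m Nc : ℕ) where
  A : Mat n n
  B : Mat n m
  b : Fin Nc → ℕ
  Bc : ∀ ι, Mat n (b ι)

/-- The gains `K ι` stabilize the plant: every trajectory under the state feedback
`u^ι = K ι x` converges to zero. -/
def Plant.IsStabilizedBy {n m Nc : ℕ} (P : Plant n m Nc) (K : ∀ ι, Mat (P.b ι) n) : Prop :=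
  ∀ x : ℝ → Vec n,
    HasVelocity x (fun t => P.A.act (x t) + ∑ ι, (P.Bc ι).act ((K ι).act (x t))) →
    Tendsto (fun t => ‖x t‖) atTop (𝓝 0)

/-- A quadruple of matrices `(T, E, F, G)` of the sizes used by an observer node. -/
structure Quadruple (n p δ : ℕ) where
  T : Mat n δ
  E : Mat δ δ
  F : Mat δ p
  G : Mat δ p

/-- The set `Ω(δ)` of quadruples `(T, E, F, G)` with
`Tᵀ T = I`, `G C B₋ = Tᵀ B₋`, `E Tᵀ + (G C - Tᵀ) A + (F - E G) C = 0`, and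
`E` Hurwitz or `E = 0_{p × p}`. -/
def decompSet {n q p : ℕ} (A : Mat n n) (Bneg : Mat n q) (C : Mat p n) (δ : ℕ) :
    Set (Quadruple n p δ) :=
  {Q | Q.T.transpose * Q.T = 1 ∧
    Q.G * C * Bneg = Q.T.transpose * Bneg ∧
    Q.E * Q.T.transpose + (Q.G * C - Q.T.transpose) * A + (Q.F - Q.E * Q.G) * C = 0 ∧
    (IsHurwitz Q.E ∨ (δ = p ∧ Q.E = 0))}

/-- All the data of one observer node. The node measures `y = C x` and receives the local input
`uloc = ∑ ι, S ι u^ι`, which enters the plant through `Bloc`; the remaining input enters the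
plant through `Bneg`. `Q` and `Tu` are the design matrices, `φ` and `φs` the step sizes. -/
structure ObserverNode (n : ℕ) {Nc : ℕ} (b : Fin Nc → ℕ) where
  p : ℕ
  q : ℕ
  qneg : ℕ
  δ : ℕ
  C : Mat p n
  S : ∀ ι, Mat q (b ι)
  Bloc : Mat n q
  Bneg : Mat n qneg
  Q : Quadruple n p δ
  Tu : Mat n (n - δ)
  φ : ℝ
  φs : ℝ

namespace ObserverNode

variable {n Nc : ℕ} {b : Fin Nc → ℕ}

/-- The conditions on the data and the design of an observer node, for the plant matrix `A`. -/
structure IsDesigned (o : ObserverNode n b) (A : Mat n n) : Prop where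
  /-- `C` has full row rank. -/
  rank_C : o.C.rank = o.p
  /-- The input matrix of the unavailable inputs has full column rank. -/
  rank_Bneg : o.Bneg.rank = o.qneg
  /-- The quadruple belongs to `Ω(δ)`. -/
  mem : o.Q ∈ decompSet A o.Bneg o.C o.δ
  /-- `δ` is the largest index with `Ω(δ)` nonempty. -/
  maximal : ∀ ε : ℕ, 0 < ε → decompSet A o.Bneg o.C (o.δ + ε) = ∅
  /-- In the case `E = 0` the functional `Tᵀ x` is read off the output: `Tᵀ = G C`. -/
  zero_case : o.Q.E = 0 → o.Q.G * o.C = o.Q.T.transpose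
  /-- `Tu` completes `T` to an orthonormal basis. -/
  orth : o.Q.T.transpose * o.Tu = 0
  orthonormal : o.Tu.transpose * o.Tu = 1
  complement : o.Tu * o.Tu.transpose = 1 - o.Q.T * o.Q.T.transpose
  φ_pos : 0 < o.φ
  φs_pos : 0 < o.φs

/-- `Ē = T E Tᵀ + Tu Tuᵀ A`. -/
def Ebar (o : ObserverNode n b) (A : Mat n n) : Mat n n :=
  o.Q.T * o.Q.E * o.Q.T.transpose + o.Tu * o.Tu.transpose * A

/-- `Ḡ = T G`. -/
def Gbar (o : ObserverNode n b) : Mat n o.p := o.Q.T * o.Q.G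

/-- `F̄ = T F + Tu Tuᵀ A Ḡ`. -/
def Fbar (o : ObserverNode n b) (A : Mat n n) : Mat n o.p :=
  o.Q.T * o.Q.F + o.Tu * o.Tu.transpose * A * o.Gbar

/-- `B̄ = (I - Ḡ C) Bloc`. -/
def Bbar (o : ObserverNode n b) : Mat n o.q := (1 - o.Gbar * o.C) * o.Bloc

end ObserverNode

/-- `a` is the weighted adjacency matrix of the undirected graph `𝒢` (without self-loops). -/
structure IsWeightedAdjacency {N : ℕ} (𝒢 : SimpleGraph (Fin N)) (a : Mat N N) : Prop where
  symm : ∀ i j, a i j = a j i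
  pos : ∀ i j, 𝒢.Adj i j → 0 < a i j
  zero : ∀ i j, ¬ 𝒢.Adj i j → a i j = 0

/-! ### The closed loop -/

/-- The setting of the tracking problem: plant, observer nodes, weights of the communication
graph, feedback gains, reference signals, and for each controller node `ι` the observer node
`src ι` whose estimate it uses. -/
structure Setting (n m Nc N : ℕ) where
  P : Plant n m Nc
  obs : Fin N → ObserverNode n P.b
  a : Mat N N
  K : ∀ ι, Mat (P.b ι) n
  r : ∀ ι, ℝ → Vec (P.b ι)
  src : Fin Nc → Fin N

/-- The signals of the closed loop: plant state `x`, plant input `u`, the inputs `uneg i` that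
are unavailable to the observer nodes, observer states `z i`, adaptive gains `γ i`, `γs i`, and
the values `η i` taken by the discontinuous term. -/
structure Signals {n m Nc N : ℕ} (D : Setting n m Nc N) where
  x : ℝ → Vec n
  u : ℝ → Vec m
  uneg : ∀ i, ℝ → Vec (D.obs i).qneg
  z : Fin N → ℝ → Vec n
  γ : Fin N → ℝ → ℝ
  γs : Fin N → ℝ → ℝ
  η : ∀ i, ℝ → Vec (n - (D.obs i).δ)

namespace Signals

variable {n m Nc N : ℕ} {D : Setting n m Nc N}

/-- The measured output `y_i = C_i x`. -/
noncomputable def y (s : Signals D) (i : Fin N) (t : ℝ) : Vec (D.obs i).p :=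
  (D.obs i).C.act (s.x t)

/-- The state estimate `x̂_i = z_i + Ḡ_i y_i`. -/
noncomputable def xhat (s : Signals D) (i : Fin N) (t : ℝ) : Vec n :=
  s.z i t + (D.obs i).Gbar.act (s.y i t)

/-- The control law `u^ι = K^ι x̂_{i'} + r^ι`, where `i' = src ι`. -/
noncomputable def uc (s : Signals D) (ι : Fin Nc) (t : ℝ) : Vec (D.P.b ι) :=
  (D.K ι).act (s.xhat (D.src ι) t) + D.r ι t

/-- The local control input `u_i` received by the observer node `i`. -/
noncomputable def uloc (s : Signals D) (i : Fin N) (t : ℝ) : Vec (D.obs i).q :=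
  ∑ ι, ((D.obs i).S ι).act (s.uc ι t)

/-- `ε_{iu} = Tuᵢᵀ ∑ j, a_{ij} (x̂_i - x̂_j)`. -/
noncomputable def εu (s : Signals D) (i : Fin N) (t : ℝ) : Vec (n - (D.obs i).δ) :=
  Mat.act (D.obs i).Tu.transpose (∑ j, D.a i j • (s.xhat i t - s.xhat j t))

/-- The coupling term `H_i = γ_i Tuᵢ ε_{iu} + γ_{is} Tuᵢ h(ε_{iu})`, with the value `η_i` for
`h(ε_{iu})`. -/
noncomputable def H (s : Signals D) (i : Fin N) (t : ℝ) : Vec n :=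
  s.γ i t • (D.obs i).Tu.act (s.εu i t) + s.γs i t • (D.obs i).Tu.act (s.η i t)

/-- The signals form a trajectory on `[0, ∞)` of the closed loop of plant, observer nodes and
controller nodes. -/
structure IsClosedLoop (s : Signals D) : Prop where
  /-- The plant with `v ≡ 0`: `dx/dt = A x + B u`. -/
  plant : HasVelocity s.x (fun t => D.P.A.act (s.x t) + D.P.B.act (s.u t))
  /-- `B u = ∑ ι, B^ι u^ι`. -/
  channels : ∀ t, 0 ≤ t → D.P.B.act (s.u t) = ∑ ι, (D.P.Bc ι).act (s.uc ι t)
  /-- `B u = B_i u_i + B_{-i} u_{-i}`. -/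
  split : ∀ i t, 0 ≤ t →
    D.P.B.act (s.u t) = (D.obs i).Bloc.act (s.uloc i t) + (D.obs i).Bneg.act (s.uneg i t)
  /-- `dz_i/dt = Ē_i z_i + F̄_i y_i + B̄_i u_i - H_i`. -/
  observer : ∀ i, HasVelocity (s.z i) (fun t =>
    ((D.obs i).Ebar D.P.A).act (s.z i t) + ((D.obs i).Fbar D.P.A).act (s.y i t)
      + (D.obs i).Bbar.act (s.uloc i t) - s.H i t)
  /-- The discontinuous term is understood in the sense of Filippov. -/
  selection : ∀ i t, 0 ≤ t → s.η i t ∈ unitVecSet (s.εu i t)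
  /-- `dγ_i/dt = φ_i ‖ε_{iu}‖²`. -/
  adapt : ∀ i, HasVelocity (s.γ i) (fun t => (D.obs i).φ * ‖s.εu i t‖ ^ 2)
  /-- `dγ_{is}/dt = φ_{is} ‖ε_{iu}‖`. -/
  adapts : ∀ i, HasVelocity (s.γs i) (fun t => (D.obs i).φs * ‖s.εu i t‖)
  z_init : ∀ i, s.z i 0 = 0
  γ_init : ∀ i, 0 < s.γ i 0
  γs_init : ∀ i, 0 < s.γs i 0

end Signals

/-- `xr` is a trajectory of the reference system
`dx_r/dt = A x_r + ∑ ι, B^ι (K^ι x_r + r^ι)`. -/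
def Setting.IsReference {n m Nc N : ℕ} (D : Setting n m Nc N) (xr : ℝ → Vec n) : Prop :=
  HasVelocity xr (fun t =>
    D.P.A.act (xr t) + ∑ ι, (D.P.Bc ι).act ((D.K ι).act (xr t) + D.r ι t))

/-- Collective strong detectability: `∑ i, Im T_{id} = ℝⁿ`. -/
def Setting.IsCollectivelyDetectable {n m Nc N : ℕ} (D : Setting n m Nc N) : Prop :=
  ⨆ i, LinearMap.range (Matrix.mulVecLin (D.obs i).Q.T) = ⊤

/-! ### Calculus of trajectories in the integral sense -/

/-! Let `e_i = x̂_i - x` and `ξ = x - x_r`. The estimation errors cannot be treated before the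
tracking error: the input unknown to a node depends on all estimates, so `ξ` and the `e_i` form one
coupled system, handled by a single Lyapunov function.

The identities defining the quadruples make `T_idᵀ e_i` evolve by `E_i` alone, without unknown input
or coupling (`act_T_transpose_dynamics`). It decays if `E_i` is Hurwitz and vanishes identically if
`E_i = 0`. The complementary part satisfies `T_iuᵀ e_i' = ρ_i - γ_i ε_i - γ_is η_i`
(`act_Tu_transpose_dynamics`), where `ρ_i` collects `A e_i` and the input mismatch. Since `x_r` and
the references are bounded, `ρ_i` grows at most linearly in `ξ` and `e`, plus a constant `D`.
Finally `ξ` obeys the stable closed-loop system driven linearly by the `e_i`.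

The Lyapunov function adds the graph disagreement of the errors, quadratic forms for `ξ` and for
each `T_idᵀ e_i` (`exists_lyapunov`), and squares of `γ_i - G`, `γ_is - D`. Its derivative contains
no adaptive gain: they are replaced by the constants `G` and `D`. The unit-vector term then cancels
the constant part of `ρ_i`, and a large `G` absorbs the linear part, because connectedness and
collective detectability bound all of `e` by the `ε_i` and the `T_idᵀ e_i`
(`exists_norm_sq_le_graphLap`). So all signals and velocities are bounded, and a Barbalat argument
(`tendsto_zero_of_dissipation`) gives convergence. -/

namespace HasVelocity

variable {V W : Type} [NormedAddCommGroup V] [NormedSpace ℝ V] [NormedAddCommGroup W]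
  [NormedSpace ℝ W] {x y f g : ℝ → V}

theorem congr (h : HasVelocity x f) (hx : ∀ t, 0 ≤ t → y t = x t)
    (hf : ∀ t, 0 ≤ t → g t = f t) : HasVelocity y g := by
  intro t ht
  have hfg : Set.EqOn f g (Set.uIcc 0 t) := fun s hs => by
    rw [Set.uIcc_of_le ht] at hs
    exact (hf s hs.1).symm
  refine ⟨(h t ht).1.congr_ae ?_, ?_⟩
  · exact (ae_restrict_mem measurableSet_uIoc).mono fun s hs => hfg (Set.uIoc_subset_uIcc hs)
  · rw [hx t ht, hx 0 le_rfl, (h t ht).2, intervalIntegral.integral_congr hfg]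

theorem add (hx : HasVelocity x f) (hy : HasVelocity y g) :
    HasVelocity (fun t => x t + y t) (fun t => f t + g t) := by
  intro t ht
  refine ⟨(hx t ht).1.add (hy t ht).1, ?_⟩
  rw [intervalIntegral.integral_add (hx t ht).1 (hy t ht).1]
  dsimp only
  rw [(hx t ht).2, (hy t ht).2]
  abel

theorem clm [CompleteSpace V] [CompleteSpace W] (hx : HasVelocity x f) (L : V →L[ℝ] W) :
    HasVelocity (fun t => L (x t)) (fun t => L (f t)) := by
  intro t ht
  refine ⟨⟨L.integrable_comp (hx t ht).1.1, L.integrable_comp (hx t ht).1.2⟩, ?_⟩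
  rw [L.intervalIntegral_comp_comm (hx t ht).1]
  dsimp only
  rw [(hx t ht).2, map_add]

theorem const_smul [CompleteSpace V] (hx : HasVelocity x f) (c : ℝ) :
    HasVelocity (fun t => c • x t) (fun t => c • f t) := hx.clm (c • ContinuousLinearMap.id ℝ V)

theorem sub [CompleteSpace V] (hx : HasVelocity x f) (hy : HasVelocity y g) :
    HasVelocity (fun t => x t - y t) (fun t => f t - g t) := by
  simpa [sub_eq_add_neg] using hx.add (hy.const_smul (-1))

theorem const (v : V) : HasVelocity (fun _ => v) (fun _ => 0) := by
  intro t _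
  simp

theorem sum {ι : Type} (s : Finset ι) {x f : ι → ℝ → V} (h : ∀ i, HasVelocity (x i) (f i)) :
    HasVelocity (fun t => ∑ i ∈ s, x i t) (fun t => ∑ i ∈ s, f i t) := by
  classical
  induction s using Finset.induction_on with
  | empty => simpa using const (0 : V)
  | insert i s hi ih => simpa [Finset.sum_insert hi] using (h i).add ih

theorem sub_eq_integral (h : HasVelocity x f) {s t : ℝ} (hs : 0 ≤ s) (ht : 0 ≤ t) :
    x t - x s = ∫ τ in s..t, f τ := by
  rw [(h t ht).2, (h s hs).2, add_sub_add_left_eq_sub,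
    intervalIntegral.integral_interval_sub_left (h t ht).1 (h s hs).1]

theorem intervalIntegrable (h : HasVelocity x f) {s t : ℝ} (hs : 0 ≤ s) (ht : 0 ≤ t) :
    IntervalIntegrable f volume s t := (h s hs).1.symm.trans (h t ht).1

theorem norm_sub_le (h : HasVelocity x f) {C : ℝ} (hC : ∀ t, 0 ≤ t → ‖f t‖ ≤ C) {s t : ℝ}
    (hs : 0 ≤ s) (ht : 0 ≤ t) : ‖x t - x s‖ ≤ C * |t - s| := by
  rw [h.sub_eq_integral hs ht]
  refine intervalIntegral.norm_integral_le_of_norm_le_const fun τ hτ => hC τ ?_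
  rcases Set.mem_uIoc.1 hτ with h | h <;> linarith [h.1]

theorem continuousOn (h : HasVelocity x f) (T : ℝ) : ContinuousOn x (Set.Icc 0 T) := by
  rcases lt_or_ge T 0 with hT | hT
  · rw [Set.Icc_eq_empty (not_le.2 hT)]
    exact continuousOn_empty x
  have := intervalIntegral.continuousOn_primitive_interval' (h T hT).1 (Set.left_mem_uIcc)
  rw [Set.uIcc_of_le hT] at this
  exact (continuousOn_const.add this).congr fun t ht => (h t ht.1).2

/-- The product rule. -/
theorem mul {x y f g : ℝ → ℝ} (hx : HasVelocity x f) (hy : HasVelocity y g) :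
    HasVelocity (fun t => x t * y t) (fun t => f t * y t + x t * g t) := by
  intro t ht
  have hu : Set.uIcc 0 t = Set.Icc 0 t := Set.uIcc_of_le ht
  have hyc := hy.continuousOn t
  have hxc := hx.continuousOn t
  rw [← hu] at hyc hxc
  refine ⟨((hx t ht).1.mul_continuousOn hyc).add ((hy t ht).1.continuousOn_mul hxc), ?_⟩
  -- Nothing is known about `x` at negative times, so it is replaced by its primitive, defined on
  -- the whole line, to which integration by parts for absolutely continuous functions applies.
  have key : ∀ {x f : ℝ → ℝ}, HasVelocity x f →
      AbsolutelyContinuousOnInterval (fun s => x 0 + ∫ τ in (0 : ℝ)..s, f τ) 0 t ∧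
      ∀ᵐ s, s ∈ Set.uIcc 0 t → HasDerivAt (fun s => x 0 + ∫ τ in (0 : ℝ)..s, f τ) (f s) s := by
    intro x f h
    constructor
    · have h0 : AbsolutelyContinuousOnInterval (fun _ : ℝ => x 0) 0 t :=
        (LipschitzWith.const (x 0)).lipschitzOnWith.absolutelyContinuousOnInterval (K := 0)
      exact h0.add ((h t ht).1.absolutelyContinuousOnInterval_intervalIntegral (c := 0) (by simp))
    · filter_upwards [(h t ht).1.ae_hasDerivAt_integral] with s hs hst
      exact (hs hst 0 (by simp)).const_add (x 0)
  obtain ⟨ax, dx⟩ := key hx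
  obtain ⟨ay, dy⟩ := key hy
  have h1 := ax.integral_deriv_mul_eq_sub ay
  have h2 : ∫ s in (0 : ℝ)..t, f s * y s + x s * g s =
      ∫ s in (0 : ℝ)..t, deriv (fun s => x 0 + ∫ τ in (0 : ℝ)..s, f τ) s *
        (y 0 + ∫ τ in (0 : ℝ)..s, g τ) + (x 0 + ∫ τ in (0 : ℝ)..s, f τ) *
        deriv (fun s => y 0 + ∫ τ in (0 : ℝ)..s, g τ) s := by
    apply intervalIntegral.integral_congr_ae
    filter_upwards [dx, dy] with s hsx hsy hs
    have hs' := Set.uIoc_subset_uIcc hs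
    have hs0 : 0 ≤ s := by rw [hu] at hs'; exact hs'.1
    rw [(hsx hs').deriv, (hsy hs').deriv, ← (hx s hs0).2, ← (hy s hs0).2]
  rw [h2, h1, ← (hx t ht).2, ← (hy t ht).2]
  simp

theorem inner {n : ℕ} {x y f g : ℝ → Vec n} (hx : HasVelocity x f) (hy : HasVelocity y g) :
    HasVelocity (fun t => inner ℝ (x t) (y t))
      (fun t => inner ℝ (f t) (y t) + inner ℝ (x t) (g t)) := by
  have h := HasVelocity.sum Finset.univ fun i : Fin n =>
    (hx.clm (EuclideanSpace.proj i : Vec n →L[ℝ] ℝ)).mul (hy.clm (EuclideanSpace.proj i))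
  refine h.congr (fun t _ => ?_) (fun t _ => ?_)
  · simp [PiLp.inner_apply, mul_comm]
  · simp [PiLp.inner_apply, mul_comm, Finset.sum_add_distrib]

theorem quadratic {n : ℕ} {x f : ℝ → Vec n} (hx : HasVelocity x f) (Q : Vec n →L[ℝ] Vec n)
    (hQ : ∀ u v, (Inner.inner ℝ (Q u) v : ℝ) = Inner.inner ℝ u (Q v)) :
    HasVelocity (fun t => Inner.inner ℝ (Q (x t)) (x t))
      (fun t => 2 * Inner.inner ℝ (Q (x t)) (f t)) := by
  refine ((hx.clm Q).inner hx).congr (fun _ _ => rfl) fun t _ => ?_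
  rw [hQ (f t), real_inner_comm (Q (x t)) (f t)]
  ring

theorem norm_sq {n : ℕ} {x f : ℝ → Vec n} (hx : HasVelocity x f) :
    HasVelocity (fun t => ‖x t‖ ^ 2) (fun t => 2 * Inner.inner ℝ (x t) (f t)) := by
  refine (hx.quadratic (.id ℝ _) fun _ _ => rfl).congr (fun t _ => ?_) fun t _ => rfl
  simp

theorem sq_sub_const {x f : ℝ → ℝ} (hx : HasVelocity x f) (c : ℝ) :
    HasVelocity (fun t => (x t - c) ^ 2) (fun t => 2 * (x t - c) * f t) := by
  have h : HasVelocity (fun t => x t - c) f := (hx.sub (const c)).congr (fun _ _ => rfl) (by simp)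
  exact (h.mul h).congr (fun _ _ => by ring) (fun _ _ => by ring)

theorem le_of_nonpos {x f : ℝ → ℝ} (hx : HasVelocity x f) (hf : ∀ t, 0 ≤ t → f t ≤ 0) {t : ℝ}
    (ht : 0 ≤ t) : x t ≤ x 0 := by
  have h := hx.sub_eq_integral le_rfl ht
  have h2 := intervalIntegral.integral_mono_on (g := fun _ => (0 : ℝ)) ht
    (hx.intervalIntegrable le_rfl ht) (by simp) fun s hs => hf s hs.1
  rw [intervalIntegral.integral_zero] at h2
  linarith

theorem of_hasDerivAt [CompleteSpace V] (h : ∀ t, HasDerivAt x (f t) t) (hf : Continuous f) :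
    HasVelocity x f := by
  intro t _
  refine ⟨hf.intervalIntegrable _ _, ?_⟩
  rw [intervalIntegral.integral_eq_sub_of_hasDerivAt (fun s _ => h s)
    (hf.intervalIntegrable _ _)]
  abel

/-- A comparison principle: `dx/dt ≤ -λ x + c` keeps `x` bounded above. -/
theorem bounded_above_of_decay {x f : ℝ → ℝ} (hx : HasVelocity x f) {l c : ℝ} (hl : 0 < l)
    (hf : ∀ t, 0 ≤ t → f t ≤ -l * x t + c) : ∃ M, ∀ t, 0 ≤ t → x t ≤ M := by
  have he : HasVelocity (fun t => Real.exp (l * t)) (fun t => l * Real.exp (l * t)) := by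
    refine of_hasDerivAt (fun t => ?_) (by fun_prop)
    simpa [mul_comm] using ((hasDerivAt_id t).const_mul l).exp
  -- Integrating factor: `exp (l t) * (x t - c / l)` is nonincreasing.
  have h := (he.mul hx).sub (he.const_smul (c / l))
  have h0 : ∀ t, 0 ≤ t → Real.exp (l * t) * x t - (c / l) • Real.exp (l * t) ≤ x 0 - c / l := by
    intro t ht
    have := h.le_of_nonpos (fun s hs => ?_) ht
    · simpa using this
    · have h1 : (c / l) • (l * Real.exp (l * s)) = c * Real.exp (l * s) := by
        rw [smul_eq_mul]; field_simp
      rw [h1]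
      nlinarith [hf s hs, Real.exp_pos (l * s)]
  refine ⟨|x 0 - c / l| + c / l, fun t ht => ?_⟩
  have h1 := h0 t ht
  rw [smul_eq_mul] at h1
  have h2 : 1 ≤ Real.exp (l * t) := Real.one_le_exp (by positivity)
  have h3 := le_abs_self (x 0 - c / l)
  have h4 := abs_nonneg (x 0 - c / l)
  nlinarith

/-- A Lipschitz trajectory dominated by the decay rate of a nonnegative function tends to zero. -/
theorem tendsto_zero_of_dissipation (hx : HasVelocity x f) {C : ℝ}
    (hf : ∀ t, 0 ≤ t → ‖f t‖ ≤ C) {v w : ℝ → ℝ} (hv : HasVelocity v w) (hv0 : ∀ t, 0 ≤ t → 0 ≤ v t)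
    {κ : ℝ} (hκ : 0 < κ) (hw : ∀ t, 0 ≤ t → w t ≤ -κ * ‖x t‖ ^ 2) :
    Tendsto (fun t => ‖x t‖) atTop (𝓝 0) := by
  have hC : 0 ≤ C := (norm_nonneg _).trans (hf 0 le_rfl)
  have hdec : ∀ s t, 0 ≤ s → s ≤ t → ∀ m, 0 ≤ m → (∀ τ, s ≤ τ → τ ≤ t → m ≤ ‖x τ‖) →
      κ * m ^ 2 * (t - s) ≤ v s - v t := by
    intro s t hs hst m hm hmx
    have ht := hs.trans hst
    have h1 := hv.sub_eq_integral hs ht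
    have h2 : ∫ τ in s..t, w τ ≤ ∫ τ in s..t, -κ * m ^ 2 := by
      refine intervalIntegral.integral_mono_on hst (hv.intervalIntegrable hs ht) (by simp) ?_
      intro τ hτ
      have h3 := hw τ (hs.trans hτ.1)
      have h4 : m ^ 2 ≤ ‖x τ‖ ^ 2 := by gcongr; exact hmx τ hτ.1 hτ.2
      nlinarith
    rw [intervalIntegral.integral_const, smul_eq_mul] at h2
    linarith
  have hanti : ∀ s t, 0 ≤ s → s ≤ t → v t ≤ v s := fun s t hs hst => by
    have := hdec s t hs hst 0 le_rfl fun _ _ _ => norm_nonneg _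
    simp at this
    exact this
  have hbdd : BddBelow (v '' Set.Ici 0) := ⟨0, by rintro _ ⟨t, ht, rfl⟩; exact hv0 t ht⟩
  set ℓ := sInf (v '' Set.Ici 0)
  rw [Metric.tendsto_atTop]
  intro ε hε
  -- A trajectory of speed at most `C` with norm at least `ε` at time `t` keeps norm at least `ε /
  -- 2` during `[t, t + h]`; `C + 1` covers `C = 0`. This costs `v` the amount `κ (ε / 2)² h`, too
  -- much once `v` is that close to its infimum.
  set h := ε / (2 * (C + 1)) with hh
  have hh0 : 0 < h := by positivity
  have hη : 0 < κ * (ε / 2) ^ 2 * h := by positivity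
  obtain ⟨_, ⟨T, hT, rfl⟩, hTl⟩ := exists_lt_of_csInf_lt (⟨v 0, 0, by simp, rfl⟩ :
    (v '' Set.Ici 0).Nonempty) (show ℓ < ℓ + κ * (ε / 2) ^ 2 * h by linarith)
  refine ⟨T, fun t ht => ?_⟩
  have hT0 : (0 : ℝ) ≤ T := hT
  have ht0 : 0 ≤ t := hT0.trans ht
  rw [Real.dist_eq, sub_zero, abs_norm]
  by_contra! hcon
  have h1 := hdec t (t + h) ht0 (by linarith) (ε / 2) (by positivity) fun τ h1 h2 => by
    have h3 := hx.norm_sub_le hf (ht0.trans h1) ht0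
    have h4 := norm_sub_norm_le (x t) (x τ)
    have h5 : |t - τ| ≤ h := by rw [abs_le]; constructor <;> linarith
    have h6 : C * |t - τ| ≤ ε / 2 := by
      calc C * |t - τ| ≤ (C + 1) * h := by gcongr; linarith
        _ = ε / 2 := by rw [hh]; field_simp
    linarith
  have h2 : ℓ ≤ v (t + h) := csInf_le hbdd ⟨t + h, by simp; linarith, rfl⟩
  have h3 := hanti T t hT0 ht
  have h4 : t + h - t = h := by ring
  rw [h4] at h1
  linarith

end HasVelocity

/-! ### Matrices acting on Euclidean vectors -/

namespace Mat

variable {k l m : ℕ}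

/-- The action of a matrix as a continuous linear map. -/
noncomputable def clm (M : Mat k l) : Vec l →L[ℝ] Vec k :=
  LinearMap.toContinuousLinearMap
    { toFun := M.act
      map_add' := fun x y => by simp [Mat.act, Matrix.mulVec_add]
      map_smul' := fun c x => by simp [Mat.act, Matrix.mulVec_smul] }

@[simp] theorem clm_apply (M : Mat k l) (x : Vec l) : M.clm x = M.act x := rfl

theorem act_add (M : Mat k l) (x y : Vec l) : M.act (x + y) = M.act x + M.act y :=
  map_add M.clm x y

theorem act_sub (M : Mat k l) (x y : Vec l) : M.act (x - y) = M.act x - M.act y :=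
  map_sub M.clm x y

theorem act_smul (M : Mat k l) (c : ℝ) (x : Vec l) : M.act (c • x) = c • M.act x :=
  map_smul M.clm c x

theorem add_act (M N : Mat k l) (x : Vec l) : Mat.act (M + N) x = M.act x + N.act x := by
  simp [Mat.act, Matrix.add_mulVec]

theorem sub_act (M N : Mat k l) (x : Vec l) : Mat.act (M - N) x = M.act x - N.act x := by
  simp [Mat.act, Matrix.sub_mulVec]

theorem zero_act (x : Vec l) : Mat.act (0 : Mat k l) x = 0 := by simp [Mat.act]

theorem one_act (x : Vec l) : Mat.act (1 : Mat l l) x = x := by simp [Mat.act]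

theorem mul_act (M : Mat k l) (N : Mat l m) (x : Vec m) : Mat.act (M * N) x = M.act (N.act x) := by
  simp [Mat.act, Matrix.mulVec_mulVec]

theorem inner_act (M : Mat k l) (x : Vec l) (y : Vec k) :
    (inner ℝ (M.act x) y : ℝ) = inner ℝ x (Mat.act M.transpose y) := by
  simp only [Mat.act, EuclideanSpace.inner_eq_star_dotProduct, star_trivial]
  rw [Matrix.dotProduct_mulVec, dotProduct_comm, Matrix.mulVec_transpose, dotProduct_comm]

end Mat

/-! ### Lyapunov functions of stable linear systems -/

section Lyapunov

variable {H : Type} [NormedAddCommGroup H] [InnerProductSpace ℝ H] [CompleteSpace H]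

theorem exp_neg_mul_exp {A : Type*} [NormedRing A] [NormedAlgebra ℝ A] [CompleteSpace A] (a : A) :
    NormedSpace.exp (-a) * NormedSpace.exp a = 1 := by
  let +nondep : NormedAlgebra ℚ A := .restrictScalars ℚ ℝ A
  rw [← NormedSpace.exp_add_of_commute (Commute.refl a).neg_left, neg_add_cancel,
    NormedSpace.exp_zero]

theorem natCast_smul_exp {A : Type*} [NormedRing A] [NormedAlgebra ℝ A] [CompleteSpace A] (n : ℕ)
    (a : A) : NormedSpace.exp ((n : ℝ) • a) = NormedSpace.exp a ^ n := by
  let +nondep : NormedAlgebra ℚ A := .restrictScalars ℚ ℝ A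
  rw [Nat.cast_smul_eq_nsmul, NormedSpace.exp_nsmul]

theorem AlgHom.map_exp_of_continuous {A B : Type*} [NormedRing A] [NormedAlgebra ℝ A]
    [CompleteSpace A] [NormedRing B] [NormedAlgebra ℝ B] (φ : A →ₐ[ℝ] B) (hφ : Continuous φ)
    (a : A) : φ (NormedSpace.exp a) = NormedSpace.exp (φ a) :=
  NormedSpace.map_exp_of_mem_ball (𝕂 := ℝ) φ hφ a <|
    (NormedSpace.expSeries_radius_eq_top ℝ A).symm ▸ edist_lt_top _ _

theorem hasDerivAt_exp_smul_apply (E : H →L[ℝ] H) (x : H) (t : ℝ) :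
    HasDerivAt (fun s : ℝ => NormedSpace.exp (s • E) x) (NormedSpace.exp (t • E) (E x)) t :=
  (hasDerivAt_exp_smul_const (𝕂 := ℝ) E t).clm_apply (hasDerivAt_const t x) |>.congr_deriv
    (by simp)

theorem ContinuousLinearMap.natCast_smul_exp (n : ℕ) (E : H →L[ℝ] H) :
    NormedSpace.exp ((n : ℝ) • E) = NormedSpace.exp E ^ n := _root_.natCast_smul_exp n E

theorem continuous_exp_smul (E : H →L[ℝ] H) :
    Continuous (fun s : ℝ => NormedSpace.exp (s • E)) :=
  continuous_iff_continuousAt.2 fun t =>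
    (hasDerivAt_exp_smul_const (𝕂 := ℝ) E t).continuousAt

/-- `Q = 2 ∫₀ᵀ S(s)* S(s) ds` with `S(s) = exp (s E)`. The derivative of its form along the flow
telescopes to `2 (‖S(T) x‖² - ‖x‖²) ≤ -(3/2) ‖x‖²`. A finite horizon with one contraction bound
replaces an improper integral and a decay rate. -/
theorem exists_lyapunov (E : H →L[ℝ] H) {T : ℝ} (hT : 0 < T)
    (hE : ‖NormedSpace.exp (T • E)‖ ≤ 1 / 2) :
    ∃ Q : H →L[ℝ] H, ∃ c : ℝ, 0 < c ∧
      (∀ u v, (inner ℝ (Q u) v : ℝ) = inner ℝ u (Q v)) ∧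
      (∀ x, c * ‖x‖ ^ 2 ≤ inner ℝ (Q x) x) ∧
      ∀ x, 2 * inner ℝ (Q x) (E x) ≤ -‖x‖ ^ 2 := by
  -- A bound on the backward flow keeps `‖S s x‖` away from zero, whence the positivity of `Q`.
  obtain ⟨M, hM⟩ := (isCompact_Icc (a := (0 : ℝ)) (b := T)).exists_bound_of_continuousOn
    ((continuous_exp_smul E).comp continuous_neg).continuousOn
  set S : ℝ → H →L[ℝ] H := fun s => NormedSpace.exp (s • E) with hS
  have hSc : Continuous S := continuous_exp_smul E
  set F : ℝ → H →L[ℝ] H := fun s => (ContinuousLinearMap.adjoint (S s)).comp (S s) with hF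
  have hFc : Continuous F :=
    (ContinuousLinearMap.adjoint.continuous.comp hSc).clm_comp hSc
  have hQ : ∀ u v : H, (inner ℝ ((∫ s in (0 : ℝ)..T, F s) u) v : ℝ) =
      ∫ s in (0 : ℝ)..T, (inner ℝ (S s u) (S s v) : ℝ) := by
    intro u v
    have h := ContinuousLinearMap.intervalIntegral_comp_comm
      ((innerSL ℝ v).comp (ContinuousLinearMap.apply ℝ H u))
      (hFc.intervalIntegrable (μ := volume) 0 T)
    rw [real_inner_comm]
    refine Eq.trans h.symm (intervalIntegral.integral_congr fun s _ => ?_)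
    simp only [hF, ContinuousLinearMap.comp_apply, ContinuousLinearMap.apply_apply,
      innerSL_apply_apply]
    rw [ContinuousLinearMap.adjoint_inner_right, real_inner_comm]
  have hSu : ∀ u, Continuous fun s => S s u := fun u => hSc.clm_apply continuous_const
  refine ⟨(2 : ℝ) • ∫ s in (0 : ℝ)..T, F s, 2 * (T * ((|M| + 1))⁻¹ ^ 2), by positivity,
    fun u v => ?_, fun x => ?_, fun x => ?_⟩
  · simp only [smul_apply, inner_smul_left, inner_smul_right]
    rw [hQ, real_inner_comm, hQ]
    simp [real_inner_comm]
  · simp only [smul_apply, inner_smul_left]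
    rw [hQ]
    have h1 : ∫ s in (0 : ℝ)..T, ((|M| + 1))⁻¹ ^ 2 * ‖x‖ ^ 2 ≤
        ∫ s in (0 : ℝ)..T, (inner ℝ (S s x) (S s x) : ℝ) := by
      refine intervalIntegral.integral_mono_on hT.le (by simp)
        (((hSu x).inner (hSu x)).intervalIntegrable _ _) fun s hs => ?_
      rw [real_inner_self_eq_norm_sq, ← mul_pow]
      gcongr
      rw [inv_mul_le_iff₀ (by positivity)]
      have h2 : x = NormedSpace.exp (-s • E) (S s x) := by
        have : NormedSpace.exp (-s • E) * S s = 1 := by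
          change NormedSpace.exp (-s • E) * NormedSpace.exp (s • E) = 1
          rw [neg_smul]
          exact exp_neg_mul_exp (s • E)
        exact (congrArg (fun L : H →L[ℝ] H => L x) this).symm
      have h3 : ‖NormedSpace.exp (-s • E)‖ ≤ |M| + 1 := by
        have := hM s hs
        simp only [Function.comp_apply] at this
        linarith [le_abs_self M]
      calc ‖x‖ = ‖NormedSpace.exp (-s • E) (S s x)‖ := by rw [← h2]
        _ ≤ ‖NormedSpace.exp (-s • E)‖ * ‖S s x‖ := ContinuousLinearMap.le_opNorm _ _
        _ ≤ _ := by gcongr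
    rw [intervalIntegral.integral_const, smul_eq_mul, sub_zero] at h1
    simp only [conj_trivial]
    linarith
  · simp only [smul_apply, inner_smul_left]
    rw [hQ]
    have h1 : ∫ s in (0 : ℝ)..T, (2 * inner ℝ (S s x) (S s (E x)) : ℝ) =
        ‖S T x‖ ^ 2 - ‖S 0 x‖ ^ 2 := by
      refine intervalIntegral.integral_eq_sub_of_hasDerivAt (f := fun s => ‖S s x‖ ^ 2)
        (fun s _ => ?_) ((continuous_const.mul ((hSu x).inner (hSu _))).intervalIntegrable _ _)
      exact (hasDerivAt_exp_smul_apply E x s).norm_sq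
    rw [intervalIntegral.integral_const_mul] at h1
    have h2 : S 0 x = x := by simp [hS]
    have h3 : ‖S T x‖ ≤ 1 / 2 * ‖x‖ := (S T).le_of_opNorm_le hE x
    have h4 : ‖S T x‖ ^ 2 ≤ (1 / 2 * ‖x‖) ^ 2 := by gcongr
    rw [h2] at h1
    simp only [conj_trivial]
    rw [mul_pow] at h4
    nlinarith [sq_nonneg ‖x‖]

/-- If every trajectory of `dx/dt = E x` tends to zero, then so does the matrix exponential. -/
theorem exists_exp_small_of_tendsto [FiniteDimensional ℝ H] (E : H →L[ℝ] H)
    (h : ∀ x : ℝ → H, HasVelocity x (fun t => E (x t)) →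
      Tendsto (fun t => ‖x t‖) atTop (𝓝 0)) :
    ∃ T : ℝ, 0 < T ∧ ‖NormedSpace.exp (T • E)‖ ≤ 1 / 2 := by
  obtain ⟨C, hC, hb⟩ := (stdOrthonormalBasis ℝ H).toBasis.exists_opNorm_le
    (F := H) (𝕜 := ℝ)
  have h1 : ∀ v : H, Tendsto (fun t : ℝ => ‖NormedSpace.exp (t • E) v‖) atTop (𝓝 0) := by
    intro v
    refine h _ (HasVelocity.of_hasDerivAt (fun t => ?_) ?_)
    · refine (hasDerivAt_exp_smul_apply E v t).congr_deriv ?_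
      have : Commute (NormedSpace.exp (t • E)) E :=
        ((Commute.refl E).smul_left t).exp_left
      exact congrArg (fun L : H →L[ℝ] H => L v) this.eq
    · exact E.continuous.comp ((continuous_exp_smul E).clm_apply continuous_const)
  have h2 : ∀ᶠ t : ℝ in atTop, ∀ i, ‖NormedSpace.exp (t • E)
      ((stdOrthonormalBasis ℝ H).toBasis i)‖ ≤ 1 / (2 * C) := by
    rw [eventually_all]
    exact fun i => (h1 _).eventually_le_const (by positivity)
  obtain ⟨T, hT, hT0⟩ := (h2.and (eventually_gt_atTop 0)).exists
  refine ⟨T, hT0, (hb (by positivity) hT).trans_eq ?_⟩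
  field_simp

end Lyapunov

/-! ### Hurwitz matrices -/

section Hurwitz

open scoped Matrix.Norms.Operator

variable {k : ℕ}

/-- The exponential of a complex matrix is a polynomial in this matrix. -/
theorem Matrix.exists_aeval_eq_exp (M : Matrix (Fin k) (Fin k) ℂ) :
    ∃ p : Polynomial ℂ, Polynomial.aeval M p = NormedSpace.exp M := by
  -- The algebra generated by `M` is finite-dimensional, hence closed, and contains the partial sums
  -- of the exponential series.
  have hcl : IsClosed ((Algebra.adjoin ℂ {M}).toSubmodule : Set (Matrix (Fin k) (Fin k) ℂ)) :=
    Submodule.closed_of_finiteDimensional _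
  have hmem : NormedSpace.exp M ∈ (Algebra.adjoin ℂ {M}).toSubmodule := by
    refine hcl.mem_of_tendsto (NormedSpace.exp_series_hasSum_exp' (𝕂 := ℂ) M).tendsto_sum_nat
      (Eventually.of_forall fun n => ?_)
    refine Submodule.sum_mem _ fun i _ => Submodule.smul_mem _ _ ?_
    exact pow_mem (Algebra.self_mem_adjoin_singleton ℂ M) i
  rw [Subalgebra.mem_toSubmodule, Algebra.adjoin_singleton_eq_range_aeval] at hmem
  exact hmem

theorem Matrix.pow_mulVec_of_eigen {M : Matrix (Fin k) (Fin k) ℂ} {v : Fin k → ℂ} {μ : ℂ}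
    (h : M.mulVec v = μ • v) (n : ℕ) : (M ^ n).mulVec v = μ ^ n • v := by
  induction n with
  | zero => simp
  | succ n ih =>
    rw [pow_succ, ← Matrix.mulVec_mulVec, h, Matrix.mulVec_smul, ih, smul_smul, pow_succ, mul_comm]

theorem Matrix.exp_mulVec_of_eigen {M : Matrix (Fin k) (Fin k) ℂ} {v : Fin k → ℂ} {μ : ℂ}
    (h : M.mulVec v = μ • v) : (NormedSpace.exp M).mulVec v = Complex.exp μ • v := by
  have h1 := (NormedSpace.exp_series_hasSum_exp' (𝕂 := ℂ) M).map
    ((Matrix.mulVecBilin ℂ ℂ).flip v) (by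
      change Continuous fun N : Matrix (Fin k) (Fin k) ℂ => N.mulVec v
      fun_prop)
  have h2 := (NormedSpace.exp_series_hasSum_exp' (𝕂 := ℂ) μ).smul_const v
  rw [← Complex.exp_eq_exp_ℂ] at h2
  refine h1.unique ?_
  convert h2 using 2 with n
  change ((n.factorial : ℂ)⁻¹ • M ^ n).mulVec v = _
  rw [Matrix.smul_mulVec, Matrix.pow_mulVec_of_eigen h, smul_assoc]

/-- Since `exp M = p(M)`, the polynomial spectral mapping theorem gives `z = p(μ)` for an eigenvalue
`μ`; applying both sides of `exp M = p(M)` to an eigenvector shows `p(μ) = exp μ`. -/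
theorem Matrix.exp_of_mem_spectrum_exp {M : Matrix (Fin k) (Fin k) ℂ} {z : ℂ}
    (hz : z ∈ spectrum ℂ (NormedSpace.exp M)) : ∃ μ ∈ spectrum ℂ M, z = Complex.exp μ := by
  have : Nontrivial (Matrix (Fin k) (Fin k) ℂ) := by
    by_contra hn
    rw [not_nontrivial_iff_subsingleton] at hn
    rw [spectrum.of_subsingleton] at hz
    exact hz
  obtain ⟨p, hp⟩ := M.exists_aeval_eq_exp
  rw [← hp, spectrum.map_polynomial_aeval] at hz
  obtain ⟨μ, hμ, rfl⟩ := hz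
  refine ⟨μ, hμ, ?_⟩
  have hdet : ¬ IsUnit (algebraMap ℂ (Matrix (Fin k) (Fin k) ℂ) μ - M) := hμ
  rw [Matrix.isUnit_iff_isUnit_det, isUnit_iff_ne_zero, not_not] at hdet
  obtain ⟨v, hv, hMv⟩ := Matrix.exists_mulVec_eq_zero_iff.2 hdet
  rw [Matrix.sub_mulVec, sub_eq_zero, Algebra.algebraMap_eq_smul_one, Matrix.smul_mulVec,
    Matrix.one_mulVec] at hMv
  have h1 : ∀ q : Polynomial ℂ, (Polynomial.aeval M q).mulVec v = q.eval μ • v := by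
    intro q
    induction q using Polynomial.induction_on' with
    | add p q ihp ihq => rw [map_add, Matrix.add_mulVec, ihp, ihq, Polynomial.eval_add, add_smul]
    | monomial n a =>
      rw [Polynomial.aeval_monomial, Algebra.algebraMap_eq_smul_one, smul_mul_assoc, one_mul,
        Matrix.smul_mulVec, Matrix.pow_mulVec_of_eigen hMv.symm, Polynomial.eval_monomial,
        smul_smul]
  have h1 := h1 p
  rw [hp, Matrix.exp_mulVec_of_eigen hMv.symm] at h1
  exact (smul_left_injective ℂ hv h1).symm

/-- Gelfand's formula: eventually `‖a ^ n‖ ≤ r ^ n` for any `r` strictly between the spectral radius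
and `1`. -/
theorem tendsto_pow_zero_of_spectralRadius_lt_one {A : Type*} [NormedRing A] [NormedAlgebra ℂ A]
    [CompleteSpace A] {a : A} (h : spectralRadius ℂ a < 1) :
    Tendsto (fun n : ℕ => a ^ n) atTop (𝓝 0) := by
  obtain ⟨r, hr, hr1⟩ := ENNReal.lt_iff_exists_nnreal_btwn.1 h
  have hr1' : (r : ℝ) < 1 := by exact_mod_cast hr1
  have h1 := (spectrum.pow_nnnorm_pow_one_div_tendsto_nhds_spectralRadius a).eventually_lt_const hr
  refine squeeze_zero_norm' ?_ (tendsto_pow_atTop_nhds_zero_of_lt_one r.2 hr1')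
  filter_upwards [h1, eventually_gt_atTop 0] with n hn hn0
  have h2 := ENNReal.rpow_lt_rpow hn (show (0 : ℝ) < n by exact_mod_cast hn0)
  rw [← ENNReal.rpow_mul, one_div, inv_mul_cancel₀ (by positivity), ENNReal.rpow_one,
    ENNReal.rpow_natCast] at h2
  exact_mod_cast h2.le

/-- The eigenvalues of `exp E` have modulus `exp (Re μ) < 1`, so the powers `(exp E) ^ n = exp (n
E)` tend to zero and a large integer time works. -/
theorem IsHurwitz.exists_exp_small {E : Mat k k} (hE : IsHurwitz E) :
    ∃ T : ℝ, 0 < T ∧ ‖NormedSpace.exp (T • Mat.clm E)‖ ≤ 1 / 2 := by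
  rcases isEmpty_or_nonempty (Fin k) with hk | hk
  · refine ⟨1, one_pos, ?_⟩
    refine ContinuousLinearMap.opNorm_le_bound _ (by norm_num) fun x => ?_
    rw [Subsingleton.elim ((NormedSpace.exp ((1 : ℝ) • Mat.clm E)) x) 0, norm_zero]
    positivity
  set φ : Matrix (Fin k) (Fin k) ℝ →ₐ[ℝ] Matrix (Fin k) (Fin k) ℂ :=
    Complex.ofRealAm.mapMatrix with hφ
  have hφc : Continuous φ := by
    change Continuous fun N : Matrix (Fin k) (Fin k) ℝ => N.map (Complex.ofRealAm)
    exact continuous_id.matrix_map Complex.continuous_ofReal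
  have hr : spectralRadius ℂ (NormedSpace.exp (φ E)) < 1 := by
    have : (1 : ENNReal) = ((1 : NNReal) : ENNReal) := rfl
    rw [this]
    refine spectrum.spectralRadius_lt_of_forall_lt _ fun z hz => ?_
    obtain ⟨μ, hμ, rfl⟩ := Matrix.exp_of_mem_spectrum_exp hz
    have h1 : μ.re < 0 := hE μ hμ
    rw [← NNReal.coe_lt_coe, coe_nnnorm, Complex.norm_exp]
    simpa using h1
  have h1 := tendsto_pow_zero_of_spectralRadius_lt_one hr
  have h2 : Tendsto (fun n : ℕ => NormedSpace.exp E ^ n) atTop (𝓝 0) := by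
    have h0 : φ (NormedSpace.exp E) = NormedSpace.exp (φ E) := φ.map_exp_of_continuous hφc E
    rw [← h0] at h1
    -- Back to real matrices: the entries of the real powers are the real parts of the complex ones.
    refine tendsto_pi_nhds.2 fun i => tendsto_pi_nhds.2 fun j => ?_
    have h3 := ((tendsto_pi_nhds.1 (tendsto_pi_nhds.1 h1 i)) j)
    have h4 := (Complex.continuous_re.tendsto _).comp h3
    refine h4.congr fun n => ?_
    simp only [Function.comp_apply, ← map_pow]
    simp [hφ]
  set ψ : Matrix (Fin k) (Fin k) ℝ →ₐ[ℝ] (Vec k →L[ℝ] Vec k) :=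
    (Matrix.toEuclideanCLM (𝕜 := ℝ) (n := Fin k)).toAlgEquiv.toAlgHom with hψ
  have hψE : ∀ M, ψ M = Mat.clm M := fun M => by
    ext x
    rfl
  have hψc : Continuous ψ :=
    ψ.toLinearMap.continuous_of_finiteDimensional
  have h3 : Tendsto (fun n : ℕ => ‖ψ (NormedSpace.exp E ^ n)‖) atTop (𝓝 0) := by
    have := ((hψc.tendsto 0).comp h2).norm
    simpa using this
  obtain ⟨n, hn, hn0⟩ := ((h3.eventually_le_const (show (0 : ℝ) < 1 / 2 by norm_num)).and
    (eventually_gt_atTop 0)).exists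
  refine ⟨n, by exact_mod_cast hn0, ?_⟩
  have h4 : ψ (NormedSpace.exp E) = NormedSpace.exp (ψ E) := ψ.map_exp_of_continuous hψc E
  rw [map_pow, h4, hψE] at hn
  have h5 : NormedSpace.exp ((n : ℝ) • Mat.clm E) = NormedSpace.exp (Mat.clm E) ^ n :=
    ContinuousLinearMap.natCast_smul_exp n _
  rwa [h5]

end Hurwitz

/-- Both sides vanish at `ω = 0` whatever `η` is, so the Lyapunov estimate is insensitive to the
Filippov selection. -/
theorem inner_of_mem_unitVecSet {k : ℕ} {ω η : Vec k} (h : η ∈ unitVecSet ω) :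
    (inner ℝ ω η : ℝ) = ‖ω‖ := by
  by_cases hω : ω = 0
  · simp [hω]
  · rw [h.1 hω, unitVec]
    simp only [hω, if_false, inner_smul_right, real_inner_self_eq_norm_sq]
    have : ‖ω‖ ≠ 0 := norm_ne_zero_iff.2 hω
    field_simp

/-! ### Weighted graph Laplacians acting on families of vectors -/

section Laplacian

variable {n N : ℕ}

/-- The weighted Laplacian `∑ j, a i j • (x i - x j)`. -/
def graphLap (a : Mat N N) (x : Fin N → Vec n) (i : Fin N) : Vec n := ∑ j, a i j • (x i - x j)

/-- The disagreement `∑ i j, a i j * ‖x i - x j‖²`. -/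
noncomputable def disagreement (a : Mat N N) (x : Fin N → Vec n) : ℝ :=
  ∑ i, ∑ j, a i j * ‖x i - x j‖ ^ 2

/-- Summation by parts on the graph: average the double sum with its copy under exchange of `i` and
`j`. -/
theorem two_mul_sum_inner_graphLap {a : Mat N N} (ha : ∀ i j, a i j = a j i)
    (x y : Fin N → Vec n) :
    2 * ∑ i, (inner ℝ (graphLap a x i) (y i) : ℝ) =
      ∑ i, ∑ j, a i j * (inner ℝ (x i - x j) (y i - y j) : ℝ) := by
  have h1 : ∑ i, (inner ℝ (graphLap a x i) (y i) : ℝ) =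
      ∑ i, ∑ j, a i j * (inner ℝ (x i - x j) (y i) : ℝ) := by
    simp [graphLap, sum_inner, inner_smul_left]
  have h2 : ∑ i, ∑ j, a i j * (inner ℝ (x i - x j) (y i) : ℝ) =
      ∑ i, ∑ j, -(a i j * (inner ℝ (x i - x j) (y j) : ℝ)) := by
    rw [Finset.sum_comm]
    refine Finset.sum_congr rfl fun i _ => Finset.sum_congr rfl fun j _ => ?_
    rw [ha j i, ← neg_sub (x i) (x j), inner_neg_left, mul_neg]
  rw [two_mul, h1]
  nth_rw 2 [h2]
  rw [← Finset.sum_add_distrib]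
  refine Finset.sum_congr rfl fun i _ => ?_
  rw [← Finset.sum_add_distrib]
  refine Finset.sum_congr rfl fun j _ => ?_
  rw [inner_sub_right]
  ring

theorem disagreement_eq {a : Mat N N} (ha : ∀ i j, a i j = a j i) (x : Fin N → Vec n) :
    disagreement a x = 2 * ∑ i, (inner ℝ (graphLap a x i) (x i) : ℝ) := by
  rw [two_mul_sum_inner_graphLap ha]
  simp [disagreement]

theorem disagreement_nonneg {a : Mat N N} (ha : ∀ i j, 0 ≤ a i j) (x : Fin N → Vec n) :
    0 ≤ disagreement a x :=
  Finset.sum_nonneg fun i _ => Finset.sum_nonneg fun j _ => mul_nonneg (ha i j) (sq_nonneg _)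

/-- The disagreement is twice the quadratic form of the symmetric Laplacian, so its gradient is four
times the Laplacian; hence the weight `1 / 4` in the Lyapunov function below. -/
theorem HasVelocity.disagreement {a : Mat N N} (ha : ∀ i j, a i j = a j i)
    {e f : Fin N → ℝ → Vec n} (h : ∀ i, HasVelocity (e i) (f i)) :
    HasVelocity (fun t => _root_.disagreement a fun i => e i t)
      (fun t => 4 * ∑ i, (Inner.inner ℝ (graphLap a (fun i => e i t) i) (f i t) : ℝ)) := by
  refine (HasVelocity.sum Finset.univ fun i => HasVelocity.sum Finset.univ fun j =>
    (((h i).sub (h j)).norm_sq.const_smul (a i j))).congr (fun t _ => rfl) fun t _ => ?_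
  rw [show (4 : ℝ) = 2 * 2 by norm_num, mul_assoc, two_mul_sum_inner_graphLap ha, Finset.mul_sum]
  refine Finset.sum_congr rfl fun i _ => ?_
  rw [Finset.mul_sum]
  refine Finset.sum_congr rfl fun j _ => ?_
  rw [smul_eq_mul]
  ring

theorem exists_norm_graphLap_le (a : Mat N N) :
    ∃ C : ℝ, 0 ≤ C ∧ ∀ (x : Fin N → Vec n) i, ‖graphLap a x i‖ ≤ C * ‖x‖ := by
  obtain ⟨M, hM⟩ := Finite.exists_le fun i => ∑ j, |a i j| * 2
  refine ⟨max M 0, le_max_right _ _, fun x i => ?_⟩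
  calc ‖graphLap a x i‖ ≤ ∑ j, ‖a i j • (x i - x j)‖ := norm_sum_le _ _
    _ ≤ ∑ j, |a i j| * 2 * ‖x‖ := by
      refine Finset.sum_le_sum fun j _ => ?_
      rw [norm_smul, Real.norm_eq_abs, mul_assoc]
      gcongr
      linarith [norm_sub_le (x i) (x j), norm_le_pi_norm x i, norm_le_pi_norm x j]
    _ = (∑ j, |a i j| * 2) * ‖x‖ := (Finset.sum_mul _ _ _).symm
    _ ≤ max M 0 * ‖x‖ := by
      gcongr
      exact (hM i).trans (le_max_left _ _)

/-- On a connected graph the disagreement, together with functionals without common kernel,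
controls the norm. -/
theorem exists_norm_sq_le_disagreement {𝒢 : SimpleGraph (Fin N)} {a : Mat N N}
    (ha : IsWeightedAdjacency 𝒢 a) (hG : 𝒢.Connected) {d : Fin N → ℕ}
    (T : ∀ i, Vec n →L[ℝ] Vec (d i)) (hT : ∀ v, (∀ i, T i v = 0) → v = 0) :
    ∃ K : ℝ, 0 < K ∧ ∀ x : Fin N → Vec n,
      ‖x‖ ^ 2 ≤ K * (disagreement a x + ∑ i, ‖T i (x i)‖ ^ 2) := by
  have hnn : ∀ i j, 0 ≤ a i j := fun i j => by
    by_cases h : 𝒢.Adj i j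
    · exact (ha.pos i j h).le
    · exact (ha.zero i j h).ge
  -- An injective linear map on a finite-dimensional space is bounded below. In the kernel of `F`,
  -- connectedness makes all `x i` equal, and the functionals then kill the common value.
  let F : (Fin N → Vec n) →ₗ[ℝ] (Fin N → Fin N → Vec n) × ((i : Fin N) → Vec (d i)) :=
    { toFun := fun x => (fun i j => √(a i j) • (x i - x j), fun i => T i (x i))
      map_add' := fun x y => by
        ext1
        · funext i j
          simp only [Pi.add_apply, Prod.fst_add, ← smul_add]
          congr 1
          abel
        · funext i
          simp
      map_smul' := fun c x => by
        ext1
        · funext i j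
          simp only [Pi.smul_apply, Prod.smul_fst, RingHom.id_apply, ← smul_sub]
          rw [smul_comm]
        · funext i
          simp }
  have hF : LinearMap.ker F = ⊥ := by
    rw [LinearMap.ker_eq_bot']
    intro x hx
    have h1 : ∀ i j, √(a i j) • (x i - x j) = 0 := fun i j =>
      congrFun (congrFun (congrArg Prod.fst hx) i) j
    have h2 : ∀ i, T i (x i) = 0 := fun i => congrFun (congrArg Prod.snd hx) i
    have h3 : ∀ i j, 𝒢.Adj i j → x i = x j := fun i j hij => by
      have := (smul_eq_zero.1 (h1 i j)).resolve_left (Real.sqrt_pos.2 (ha.pos i j hij)).ne'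
      exact sub_eq_zero.1 this
    have h4 : ∀ i j, x i = x j := fun i j => by
      obtain ⟨p⟩ := hG.preconnected i j
      induction p with
      | nil => rfl
      | cons h _ ih => exact (h3 _ _ h).trans ih
    funext i
    exact hT (x i) fun j => by rw [h4 i j]; exact h2 j
  obtain ⟨κ, hκ, hanti⟩ := F.exists_antilipschitzWith hF
  refine ⟨(κ : ℝ) ^ 2, by positivity, fun x => ?_⟩
  have h1 : ‖x‖ ≤ κ * ‖F x‖ := by
    simpa using hanti.le_mul_dist x 0
  have hd := disagreement_nonneg hnn x
  have hs : 0 ≤ ∑ i, ‖T i (x i)‖ ^ 2 := Finset.sum_nonneg fun i _ => sq_nonneg _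
  have h2 : ‖F x‖ ≤ √(disagreement a x + ∑ i, ‖T i (x i)‖ ^ 2) := by
    refine norm_prod_le_iff.2 ⟨?_, ?_⟩
    · refine (pi_norm_le_iff_of_nonneg (Real.sqrt_nonneg _)).2 fun i =>
        (pi_norm_le_iff_of_nonneg (Real.sqrt_nonneg _)).2 fun j => Real.le_sqrt_of_sq_le ?_
      have h3 : a i j * ‖x i - x j‖ ^ 2 ≤ disagreement a x :=
        (Finset.single_le_sum (f := fun j => a i j * ‖x i - x j‖ ^ 2)
          (fun j _ => mul_nonneg (hnn i j) (sq_nonneg _)) (Finset.mem_univ j)).trans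
          (Finset.single_le_sum (f := fun i => ∑ j, a i j * ‖x i - x j‖ ^ 2)
          (fun i _ => Finset.sum_nonneg fun j _ => mul_nonneg (hnn i j) (sq_nonneg _))
          (Finset.mem_univ i))
      change ‖√(a i j) • (x i - x j)‖ ^ 2 ≤ _
      rw [norm_smul, mul_pow, Real.norm_eq_abs, sq_abs, Real.sq_sqrt (hnn i j)]
      linarith
    · refine (pi_norm_le_iff_of_nonneg (Real.sqrt_nonneg _)).2 fun i => Real.le_sqrt_of_sq_le ?_
      have h3 := Finset.single_le_sum (f := fun i => ‖T i (x i)‖ ^ 2)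
        (fun i _ => sq_nonneg _) (Finset.mem_univ i)
      change ‖T i (x i)‖ ^ 2 ≤ _
      linarith
  calc ‖x‖ ^ 2 ≤ (κ * √(disagreement a x + ∑ i, ‖T i (x i)‖ ^ 2)) ^ 2 := by
        gcongr
        exact h1.trans (by gcongr)
    _ = _ := by rw [mul_pow, Real.sq_sqrt (by positivity)]

/-- As `exists_norm_sq_le_disagreement`, with the components of the Laplacian complementary to the
functionals instead of the disagreement. -/
theorem exists_norm_sq_le_graphLap {𝒢 : SimpleGraph (Fin N)} {a : Mat N N}
    (ha : IsWeightedAdjacency 𝒢 a) (hG : 𝒢.Connected) {d k : Fin N → ℕ}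
    (T : ∀ i, Vec n →L[ℝ] Vec (d i)) (U : ∀ i, Vec n →L[ℝ] Vec (k i))
    (hTU : ∀ i v w, (inner ℝ v w : ℝ) = inner ℝ (T i v) (T i w) + inner ℝ (U i v) (U i w))
    (hT : ∀ v, (∀ i, T i v = 0) → v = 0) :
    ∃ K : ℝ, 0 < K ∧ ∀ x : Fin N → Vec n,
      ‖x‖ ^ 2 ≤ K * (∑ i, ‖U i (graphLap a x i)‖ ^ 2 + ∑ i, ‖T i (x i)‖ ^ 2) := by
  obtain ⟨K, hK, h⟩ := exists_norm_sq_le_disagreement ha hG T hT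
  obtain ⟨C, hC, hlap⟩ := exists_norm_graphLap_le (n := n) a
  have hN : 0 < N := by
    obtain ⟨i⟩ := hG.nonempty
    exact i.pos
  have hN' : (0 : ℝ) < N := by exact_mod_cast hN
  have hsq : ∀ i v, ‖v‖ ^ 2 = ‖T i v‖ ^ 2 + ‖U i v‖ ^ 2 := fun i v => by
    simpa using hTU i v v
  have hTn : ∀ i v, ‖T i v‖ ≤ ‖v‖ := fun i v =>
    le_of_sq_le_sq (by nlinarith [hsq i v, sq_nonneg ‖U i v‖]) (norm_nonneg _)
  have hUn : ∀ i v, ‖U i v‖ ≤ ‖v‖ := fun i v =>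
    le_of_sq_le_sq (by nlinarith [hsq i v, sq_nonneg ‖T i v‖]) (norm_nonneg _)
  refine ⟨8 * K ^ 2 * N * (1 + C ^ 2) + 2 * K, by positivity, fun x => ?_⟩
  set P := ∑ i, ‖U i (graphLap a x i)‖ ^ 2 with hP
  set R := ∑ i, ‖T i (x i)‖ ^ 2 with hR
  have hP0 : 0 ≤ P := Finset.sum_nonneg fun i _ => sq_nonneg _
  have hR0 : 0 ≤ R := Finset.sum_nonneg fun i _ => sq_nonneg _
  -- Young's inequality with weight `2 K N`: summed over the `N` nodes and multiplied by `K`, the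
  -- first term becomes `‖x‖² / 2` and is absorbed on the left.
  have h1 : ∀ i, 2 * (inner ℝ (graphLap a x i) (x i) : ℝ) ≤ ‖x‖ ^ 2 / (2 * K * N) +
      4 * K * N * (‖U i (graphLap a x i)‖ ^ 2 + C ^ 2 * ‖T i (x i)‖ ^ 2) := by
    intro i
    have h2 : (inner ℝ (graphLap a x i) (x i) : ℝ) ≤
        ‖x‖ * (‖U i (graphLap a x i)‖ + C * ‖T i (x i)‖) := by
      rw [hTU i]
      have h3 := real_inner_le_norm (T i (graphLap a x i)) (T i (x i))
      have h4 := real_inner_le_norm (U i (graphLap a x i)) (U i (x i))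
      have h5 : ‖T i (graphLap a x i)‖ * ‖T i (x i)‖ ≤ (C * ‖x‖) * ‖T i (x i)‖ := by
        gcongr
        exact (hTn i _).trans (hlap x i)
      have h6 : ‖U i (graphLap a x i)‖ * ‖U i (x i)‖ ≤ ‖U i (graphLap a x i)‖ * ‖x‖ := by
        gcongr
        exact (hUn i _).trans (norm_le_pi_norm x i)
      linarith
    set p := ‖U i (graphLap a x i)‖
    set q := C * ‖T i (x i)‖ with hq
    have h7 : 2 * (‖x‖ * (p + q)) ≤ ‖x‖ ^ 2 / (2 * K * N) + 2 * K * N * (p + q) ^ 2 := by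
      have hy : (0 : ℝ) < 2 * K * N := by positivity
      generalize 2 * K * (N : ℝ) = y at hy
      have h8 : ‖x‖ ^ 2 / y + y * (p + q) ^ 2 - 2 * (‖x‖ * (p + q)) =
          (‖x‖ - y * (p + q)) ^ 2 / y := by field_simp; ring
      have : 0 ≤ (‖x‖ - y * (p + q)) ^ 2 / y := by positivity
      linarith
    have h9 : 2 * K * N * (p + q) ^ 2 ≤ 2 * K * N * (2 * (p ^ 2 + q ^ 2)) := by
      gcongr
      nlinarith [sq_nonneg (p - q)]
    rw [← mul_pow, ← hq]
    linarith
  have h2 : disagreement a x ≤ ‖x‖ ^ 2 / (2 * K) + 4 * K * N * (P + C ^ 2 * R) := by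
    rw [disagreement_eq ha.symm, Finset.mul_sum]
    refine (Finset.sum_le_sum fun i _ => h1 i).trans_eq ?_
    rw [Finset.sum_add_distrib, ← Finset.mul_sum, Finset.sum_add_distrib, ← Finset.mul_sum]
    simp only [Finset.sum_const, Finset.card_univ, Fintype.card_fin, nsmul_eq_mul, ← hP, ← hR]
    field_simp
  have h3 := h x
  have h4 : K * (disagreement a x + R) ≤
      K * (‖x‖ ^ 2 / (2 * K) + 4 * K * N * (P + C ^ 2 * R) + R) := by gcongr
  have h5 : K * (‖x‖ ^ 2 / (2 * K)) = ‖x‖ ^ 2 / 2 := by field_simp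
  have h6 : 0 ≤ K ^ 2 * N * (R + C ^ 2 * P) := by positivity
  have h7 : 0 ≤ K * P := by positivity
  nlinarith

end Laplacian

/-! ### Stability of adaptively coupled error dynamics -/

section Core

/-- Young's inequality for one node. The share `X² / (4 N)` makes all `N` nodes together cost only
`X² / 4`; the term `D * p` is kept exact for the unit-vector gain to cancel. -/
theorem dissipation_bound {C D p q m X N : ℝ} (hN : 0 < N) :
    C * m * (C * q) + p * (C * (X + m) + D) ≤
      (C ^ 2 + C ^ 2 + N * C ^ 2 + 1) * (p ^ 2 + q ^ 2 + m ^ 2) + X ^ 2 / (4 * N) + D * p := by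
  have h1 : C * p * X ≤ X ^ 2 / (4 * N) + N * (C * p) ^ 2 := by
    have : X ^ 2 / (4 * N) + N * (C * p) ^ 2 - C * p * X =
        (X - 2 * N * (C * p)) ^ 2 / (4 * N) := by field_simp; ring
    have : 0 ≤ (X - 2 * N * (C * p)) ^ 2 / (4 * N) := by positivity
    linarith
  have h2 : 0 ≤ N * C ^ 2 * (q ^ 2 + m ^ 2) := by positivity
  nlinarith [sq_nonneg (C * m - C * q), sq_nonneg (C * p - m), sq_nonneg (C * p), sq_nonneg p,
    sq_nonneg q, sq_nonneg (C * q), sq_nonneg (C * m), sq_nonneg m]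

theorem le_of_sq_div_le {x b φ M : ℝ} (hφ : 0 < φ) (hM : 0 ≤ M)
    (h : (x - b) ^ 2 / (2 * φ) ≤ M) : |x| ≤ 2 * φ * M + 1 + |b| := by
  rw [div_le_iff₀ (by positivity)] at h
  -- Square roots are avoided by `r ≤ r² + 1`; the same device gives the state bounds later.
  have h1 : |x - b| ≤ 2 * φ * M + 1 := by
    rw [← sq_abs] at h
    have : 0 ≤ φ * M := by positivity
    nlinarith [abs_nonneg (x - b)]
  have := abs_sub_abs_le_abs_sub x b
  linarith

set_option maxHeartbeats 1000000 in
/-- Errors `e i` with the dynamics `f i`, whose components `T i (e i)` decay autonomously and whose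
components `U i (e i)` are stabilized by the adaptive coupling, interconnected with a stable
system `ξ`: all signals stay bounded and the errors and `ξ` tend to zero. -/
theorem tendsto_zero_of_adaptive_coupling {n N : ℕ} {𝒢 : SimpleGraph (Fin N)} {a : Mat N N}
    (ha : IsWeightedAdjacency 𝒢 a) (hG : 𝒢.Connected) {d k : Fin N → ℕ}
    {T : ∀ i, Vec n →L[ℝ] Vec (d i)} {U : ∀ i, Vec n →L[ℝ] Vec (k i)}
    (hTU : ∀ i v w, (inner ℝ v w : ℝ) = inner ℝ (T i v) (T i w) + inner ℝ (U i v) (U i w))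
    (hT : ∀ v, (∀ i, T i v = 0) → v = 0)
    {e f : Fin N → ℝ → Vec n} {ξ h : ℝ → Vec n} {γ γs : Fin N → ℝ → ℝ} {φ φs : Fin N → ℝ}
    {ρ η : ∀ i, ℝ → Vec (k i)} {Qd : ∀ i, Vec (d i) →L[ℝ] Vec (d i)} {Q : Vec n →L[ℝ] Vec n}
    {C D c : ℝ} (hC : 0 ≤ C) (hc : 0 < c) (hφ : ∀ i, 0 < φ i) (hφs : ∀ i, 0 < φs i)
    (he : ∀ i, HasVelocity (e i) (f i)) (hξ : HasVelocity ξ h)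
    (hγ : ∀ i, HasVelocity (γ i) fun t => φ i * ‖U i (graphLap a (fun j => e j t) i)‖ ^ 2)
    (hγs : ∀ i, HasVelocity (γs i) fun t => φs i * ‖U i (graphLap a (fun j => e j t) i)‖)
    (hQs : ∀ u v, (inner ℝ (Q u) v : ℝ) = inner ℝ u (Q v))
    (hQp : ∀ u, c * ‖u‖ ^ 2 ≤ inner ℝ (Q u) u)
    (hQξ : ∀ t, 0 ≤ t → 2 * (inner ℝ (Q (ξ t)) (h t) : ℝ) ≤
      -‖ξ t‖ ^ 2 + C * ‖ξ t‖ * ‖fun j => e j t‖)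
    (hh : ∀ t, 0 ≤ t → ‖h t‖ ≤ C * (‖ξ t‖ + ‖fun j => e j t‖))
    (hQds : ∀ i u v, (inner ℝ (Qd i u) v : ℝ) = inner ℝ u (Qd i v))
    (hQdp : ∀ i u, c * ‖u‖ ^ 2 ≤ inner ℝ (Qd i u) u)
    (hQde : ∀ i t, 0 ≤ t → 2 * (inner ℝ (Qd i (T i (e i t))) (T i (f i t)) : ℝ) ≤
      -‖T i (e i t)‖ ^ 2)
    (hTf : ∀ i t, 0 ≤ t → ‖T i (f i t)‖ ≤ C * ‖T i (e i t)‖)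
    (hUf : ∀ i t, 0 ≤ t → U i (f i t) =
      ρ i t - γ i t • U i (graphLap a (fun j => e j t) i) - γs i t • η i t)
    (hρ : ∀ i t, 0 ≤ t → ‖ρ i t‖ ≤ C * (‖ξ t‖ + ‖fun j => e j t‖) + D)
    (hη : ∀ i t, 0 ≤ t → η i t ∈ unitVecSet (U i (graphLap a (fun j => e j t) i)))
    (hlap : ∀ (x : Fin N → Vec n) i, ‖graphLap a x i‖ ≤ C * ‖x‖) :
    Tendsto (fun t => ‖ξ t‖) atTop (𝓝 0) ∧ (∀ i, Tendsto (fun t => ‖e i t‖) atTop (𝓝 0)) ∧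
      ∀ i, IsBoundedSignal (γ i) ∧ IsBoundedSignal (γs i) := by
  have hnn : ∀ i j, 0 ≤ a i j := fun i j => by
    by_cases h : 𝒢.Adj i j
    · exact (ha.pos i j h).le
    · exact (ha.zero i j h).ge
  have hN : (0 : ℝ) < N := by
    obtain ⟨i⟩ := hG.nonempty
    exact_mod_cast i.pos
  have hsq : ∀ i v, ‖v‖ ^ 2 = ‖T i v‖ ^ 2 + ‖U i v‖ ^ 2 := fun i v => by
    simpa using hTU i v v
  have hTn : ∀ i v, ‖T i v‖ ≤ ‖v‖ := fun i v =>
    le_of_sq_le_sq (by nlinarith [hsq i v, sq_nonneg ‖U i v‖]) (norm_nonneg _)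
  have hUn : ∀ i v, ‖U i v‖ ≤ ‖v‖ := fun i v =>
    le_of_sq_le_sq (by nlinarith [hsq i v, sq_nonneg ‖T i v‖]) (norm_nonneg _)
  obtain ⟨K, hK, hKb⟩ := exists_norm_sq_le_graphLap ha hG T U hTU hT
  obtain ⟨K', hK', hKb'⟩ := exists_norm_sq_le_disagreement ha hG T hT
  set E : ℝ → Fin N → Vec n := fun t j => e j t with hE
  set ε : ∀ i, ℝ → Vec (k i) := fun i t => U i (graphLap a (E t) i) with hε
  -- the contribution of one node to the dissipation
  have hnode : ∀ i t, 0 ≤ t → (inner ℝ (graphLap a (E t) i) (f i t) : ℝ) ≤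
      (C ^ 2 + C ^ 2 + N * C ^ 2 + 1) * (‖ε i t‖ ^ 2 + ‖T i (e i t)‖ ^ 2 + ‖E t‖ ^ 2)
        + ‖ξ t‖ ^ 2 / (4 * N) + D * ‖ε i t‖ - γ i t * ‖ε i t‖ ^ 2 - γs i t * ‖ε i t‖ := by
    intro i t ht
    rw [hTU i, hUf i t ht, inner_sub_right, inner_sub_right, inner_smul_right, inner_smul_right]
    change _ + (_ - _ * inner ℝ (ε i t) (ε i t) - _ * inner ℝ (ε i t) (η i t)) ≤ _
    rw [real_inner_self_eq_norm_sq, inner_of_mem_unitVecSet (hη i t ht)]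
    have h1 : (inner ℝ (T i (graphLap a (E t) i)) (T i (f i t)) : ℝ) ≤
        C * ‖E t‖ * (C * ‖T i (e i t)‖) := by
      refine (real_inner_le_norm _ _).trans ?_
      gcongr
      · exact (hTn i _).trans (hlap _ i)
      · exact hTf i t ht
    have h2 : (inner ℝ (ε i t) (ρ i t) : ℝ) ≤ ‖ε i t‖ * (C * (‖ξ t‖ + ‖E t‖) + D) := by
      refine (real_inner_le_norm _ _).trans ?_
      gcongr
      exact hρ i t ht
    have h3 := dissipation_bound (C := C) (D := D) (p := ‖ε i t‖) (q := ‖T i (e i t)‖)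
      (m := ‖E t‖) (X := ‖ξ t‖) hN
    linarith
  obtain ⟨C₁, hC₁⟩ : ∃ C₁, C₁ = C ^ 2 + C ^ 2 + N * C ^ 2 + 1 := ⟨_, rfl⟩
  have hC₁0 : 0 ≤ C₁ := by rw [hC₁]; positivity
  rw [← hC₁] at hnode
  -- Virtual gain: `C₁` absorbs the `ε` and `T e` terms of each node, `(C₁ N + C²) K` the terms in
  -- `‖E t‖²` from the nodes and from `ξ`, and `1` is left as dissipation.
  obtain ⟨G, hGdef⟩ : ∃ G, G = C₁ + (C₁ * N + C ^ 2) * K + 1 := ⟨_, rfl⟩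
  have hG0 : 0 ≤ G := by rw [hGdef]; positivity
  set V : ℝ → ℝ := fun t => (1 / 4) * disagreement a (E t) + inner ℝ (Q (ξ t)) (ξ t)
    + ∑ i, (G * inner ℝ (Qd i (T i (e i t))) (T i (e i t)) + (γ i t - G) ^ 2 / (2 * φ i)
      + (γs i t - D) ^ 2 / (2 * φs i)) with hV
  set w : ℝ → ℝ := fun t => ∑ i, (inner ℝ (graphLap a (E t) i) (f i t) : ℝ)
    + 2 * inner ℝ (Q (ξ t)) (h t)
    + ∑ i, (G * (2 * inner ℝ (Qd i (T i (e i t))) (T i (f i t))) + (γ i t - G) * ‖ε i t‖ ^ 2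
      + (γs i t - D) * ‖ε i t‖) with hw
  have hVw : HasVelocity V w := by
    refine ((((HasVelocity.disagreement ha.symm he).const_smul (1 / 4)).add
      (hξ.quadratic Q hQs)).add (HasVelocity.sum Finset.univ fun i =>
      (((((he i).clm (T i)).quadratic (Qd i) (hQds i)).const_smul G).add
      (((hγ i).sq_sub_const G).const_smul (1 / (2 * φ i)))).add
      (((hγs i).sq_sub_const D).const_smul (1 / (2 * φs i))))).congr (fun t _ => ?_) fun t _ => ?_
    · simp only [hV, smul_eq_mul]
      refine congrArg₂ _ rfl (Finset.sum_congr rfl fun i _ => ?_)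
      ring
    · simp only [hw, smul_eq_mul]
      refine congrArg₂ _ (congrArg₂ _ ?_ rfl) (Finset.sum_congr rfl fun i _ => ?_)
      · ring
      · have h1 := (hφ i).ne'
        have h2 := (hφs i).ne'
        simp only [hε]
        field_simp
        simp only [hE]
        ring
  have hwle : ∀ t, 0 ≤ t → w t ≤ -(1 / 2) * ‖ξ t‖ ^ 2 -
      (∑ i, ‖ε i t‖ ^ 2 + ∑ i, ‖T i (e i t)‖ ^ 2) := by
    intro t ht
    -- The adaptive gains cancel: `-γ ‖ε‖² + (γ - G) ‖ε‖² = -G ‖ε‖²` and `D ‖ε‖ - γs ‖ε‖ + (γs - D)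
    -- ‖ε‖ = 0`.
    have h1 : w t ≤ 2 * inner ℝ (Q (ξ t)) (h t) + ∑ i : Fin N,
        (C₁ * (‖ε i t‖ ^ 2 + ‖T i (e i t)‖ ^ 2 + ‖E t‖ ^ 2) + ‖ξ t‖ ^ 2 / (4 * N)
          - G * (‖ε i t‖ ^ 2 + ‖T i (e i t)‖ ^ 2)) := by
      have : w t = 2 * inner ℝ (Q (ξ t)) (h t) + ∑ i, ((inner ℝ (graphLap a (E t) i) (f i t) : ℝ)
          + (G * (2 * inner ℝ (Qd i (T i (e i t))) (T i (f i t))) + (γ i t - G) * ‖ε i t‖ ^ 2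
          + (γs i t - D) * ‖ε i t‖)) := by
        rw [Finset.sum_add_distrib, hw]
        ring
      rw [this]
      gcongr with i _
      have h2 := hnode i t ht
      have h3 := mul_le_mul_of_nonneg_left (hQde i t ht) hG0
      linarith
    have h2 := hQξ t ht
    have h3 : C * ‖ξ t‖ * ‖E t‖ ≤ ‖ξ t‖ ^ 2 / 4 + C ^ 2 * ‖E t‖ ^ 2 := by
      nlinarith [sq_nonneg (‖ξ t‖ / 2 - C * ‖E t‖)]
    have h4 := hKb (E t)
    change ‖E t‖ ^ 2 ≤ K * (∑ i, ‖ε i t‖ ^ 2 + ∑ i, ‖T i (e i t)‖ ^ 2) at h4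
    rw [Finset.sum_sub_distrib, Finset.sum_add_distrib, ← Finset.mul_sum, ← Finset.mul_sum,
      Finset.sum_add_distrib, Finset.sum_add_distrib] at h1
    simp only [Finset.sum_const, Finset.card_univ, Fintype.card_fin, nsmul_eq_mul] at h1
    have h5 : (N : ℝ) * (‖ξ t‖ ^ 2 / (4 * N)) = ‖ξ t‖ ^ 2 / 4 := by field_simp
    rw [h5] at h1
    have h6 : (C₁ * N + C ^ 2) * ‖E t‖ ^ 2 ≤ (C₁ * N + C ^ 2) *
      (K * (∑ i, ‖ε i t‖ ^ 2 + ∑ i, ‖T i (e i t)‖ ^ 2)) := by gcongr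
    change 2 * _ ≤ -‖ξ t‖ ^ 2 + C * ‖ξ t‖ * ‖E t‖ at h2
    rw [hGdef] at h1
    linarith
  have hS : ∀ t, 0 ≤ ∑ i, ‖ε i t‖ ^ 2 + ∑ i, ‖T i (e i t)‖ ^ 2 := fun t =>
    add_nonneg (Finset.sum_nonneg fun i _ => sq_nonneg _) (Finset.sum_nonneg fun i _ => sq_nonneg _)
  have hVle : ∀ t, 0 ≤ t → V t ≤ V 0 := fun t ht =>
    hVw.le_of_nonpos (fun s hs => by nlinarith [hwle s hs, hS s, sq_nonneg ‖ξ s‖]) ht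
  have hterm : ∀ i t, 0 ≤ G * (inner ℝ (Qd i (T i (e i t))) (T i (e i t)) : ℝ) ∧
      0 ≤ (γ i t - G) ^ 2 / (2 * φ i) ∧ 0 ≤ (γs i t - D) ^ 2 / (2 * φs i) := fun i t => by
    have h1 := hφ i
    have h2 := hφs i
    have h3 : 0 ≤ (inner ℝ (Qd i (T i (e i t))) (T i (e i t)) : ℝ) :=
      le_trans (by positivity) (hQdp i _)
    exact ⟨by positivity, by positivity, by positivity⟩
  have hdis : ∀ t, 0 ≤ disagreement a (E t) := fun t => disagreement_nonneg hnn _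
  have hQξ0 : ∀ t, 0 ≤ (inner ℝ (Q (ξ t)) (ξ t) : ℝ) := fun t =>
    le_trans (by positivity) (hQp _)
  have hsum : ∀ t, 0 ≤ ∑ i, (G * inner ℝ (Qd i (T i (e i t))) (T i (e i t))
      + (γ i t - G) ^ 2 / (2 * φ i) + (γs i t - D) ^ 2 / (2 * φs i)) := fun t =>
    Finset.sum_nonneg fun i _ => by linarith [hterm i t]
  have hsingle : ∀ i t, 0 ≤ t → G * inner ℝ (Qd i (T i (e i t))) (T i (e i t))
      + (γ i t - G) ^ 2 / (2 * φ i) + (γs i t - D) ^ 2 / (2 * φs i) ≤ V 0 := fun i t ht => by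
    have h1 := Finset.single_le_sum (f := fun i => G * inner ℝ (Qd i (T i (e i t))) (T i (e i t))
      + (γ i t - G) ^ 2 / (2 * φ i) + (γs i t - D) ^ 2 / (2 * φs i))
      (fun i _ => by linarith [hterm i t]) (Finset.mem_univ i)
    have h2 := hVle t ht
    have h3 : V t = (1 / 4) * disagreement a (E t) + inner ℝ (Q (ξ t)) (ξ t) + _ := rfl
    linarith [hdis t, hQξ0 t]
  have hV0 : ∀ t, 0 ≤ V t := fun t => by
    have h3 : V t = (1 / 4) * disagreement a (E t) + inner ℝ (Q (ξ t)) (ξ t) + _ := rfl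
    linarith [hdis t, hQξ0 t, hsum t]
  have hγb : ∀ i t, 0 ≤ t → |γ i t| ≤ 2 * φ i * V 0 + 1 + |G| := fun i t ht =>
    le_of_sq_div_le (hφ i) (hV0 0) (by linarith [hsingle i t ht, hterm i t])
  have hγsb : ∀ i t, 0 ≤ t → |γs i t| ≤ 2 * φs i * V 0 + 1 + |D| := fun i t ht =>
    le_of_sq_div_le (hφs i) (hV0 0) (by linarith [hsingle i t ht, hterm i t])
  -- bounds of the state
  have hG1 : 1 ≤ G := by
    have : 0 ≤ (C₁ * N + C ^ 2) * K := by positivity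
    linarith
  have hξb : ∀ t, 0 ≤ t → ‖ξ t‖ ≤ V 0 / c + 1 := fun t ht => by
    have h1 : c * ‖ξ t‖ ^ 2 ≤ V 0 := by
      have h3 : V t = (1 / 4) * disagreement a (E t) + inner ℝ (Q (ξ t)) (ξ t) + _ := rfl
      linarith [hdis t, hQp (ξ t), hsum t, hVle t ht]
    have h2 : ‖ξ t‖ ^ 2 ≤ V 0 / c := by rw [le_div_iff₀ hc]; linarith
    nlinarith [norm_nonneg (ξ t)]
  obtain ⟨M, hM0, hEb⟩ : ∃ M, 0 ≤ M ∧ ∀ t, 0 ≤ t → ‖E t‖ ≤ M := by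
    refine ⟨K' * (4 * V 0 + N * (V 0 / c)) + 1, ?_, fun t ht => ?_⟩
    · have := hV0 0
      positivity
    have h1 := hKb' (E t)
    have h2 : disagreement a (E t) ≤ 4 * V 0 := by
      have h3 : V t = (1 / 4) * disagreement a (E t) + inner ℝ (Q (ξ t)) (ξ t) + _ := rfl
      linarith [hQξ0 t, hsum t, hVle t ht]
    have h3 : ∑ i, ‖T i (E t i)‖ ^ 2 ≤ N * (V 0 / c) := by
      have : ∑ i : Fin N, V 0 / c = N * (V 0 / c) := by simp
      rw [← this]
      refine Finset.sum_le_sum fun i _ => ?_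
      rw [le_div_iff₀ hc]
      have h4 := hQdp i (T i (e i t))
      have h5 : 0 ≤ (inner ℝ (Qd i (T i (e i t))) (T i (e i t)) : ℝ) :=
        le_trans (by positivity) h4
      change ‖T i (e i t)‖ ^ 2 * c ≤ _
      nlinarith [hterm i t, hsingle i t ht]
    have h4 : K' * (disagreement a (E t) + ∑ i, ‖T i (E t i)‖ ^ 2) ≤
        K' * (4 * V 0 + N * (V 0 / c)) := by gcongr
    nlinarith [norm_nonneg (E t)]
  -- Bounded velocities make the errors Lipschitz in time, as the Barbalat argument requires; the
  -- discontinuous term contributes at most `|γs i t|`.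
  have hfb : ∀ i, ∃ B, ∀ t, 0 ≤ t → ‖f i t‖ ≤ B := fun i => by
    refine ⟨C * M + (C * (V 0 / c + 1 + M) + D + (2 * φ i * V 0 + 1 + |G|) * (C * M)
      + (2 * φs i * V 0 + 1 + |D|) * 1), fun t ht => ?_⟩
    have h1 : ‖f i t‖ ≤ ‖T i (f i t)‖ + ‖U i (f i t)‖ :=
      le_of_sq_le_sq (by
        rw [hsq i]
        nlinarith [mul_nonneg (norm_nonneg (T i (f i t))) (norm_nonneg (U i (f i t)))])
        (by positivity)
    have h2 : ‖T i (f i t)‖ ≤ C * M := (hTf i t ht).trans (by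
      gcongr
      exact (hTn i _).trans ((norm_le_pi_norm (E t) i).trans (hEb t ht)))
    have h3 : ‖ρ i t‖ ≤ C * (V 0 / c + 1 + M) + D := (hρ i t ht).trans (by
      gcongr
      · exact hξb t ht
      · exact hEb t ht)
    have h4 : ‖γ i t • ε i t‖ ≤ (2 * φ i * V 0 + 1 + |G|) * (C * M) := by
      rw [norm_smul, Real.norm_eq_abs]
      gcongr
      · exact (abs_nonneg _).trans (hγb i t ht)
      · exact hγb i t ht
      · refine (hUn i _).trans ((hlap _ i).trans ?_)
        gcongr
        exact hEb t ht
    have h5 : ‖γs i t • η i t‖ ≤ (2 * φs i * V 0 + 1 + |D|) * 1 := by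
      rw [norm_smul, Real.norm_eq_abs]
      gcongr
      · exact (abs_nonneg _).trans (hγsb i t ht)
      · exact hγsb i t ht
      · exact (hη i t ht).2
    have h6 : ‖U i (f i t)‖ ≤ ‖ρ i t‖ + ‖γ i t • ε i t‖ + ‖γs i t • η i t‖ := by
      rw [hUf i t ht]
      exact (norm_sub_le _ _).trans (by gcongr; exact norm_sub_le _ _)
    linarith
  refine ⟨?_, fun i => ?_, fun i => ⟨⟨_, hγb i⟩, ⟨_, hγsb i⟩⟩⟩
  · refine hξ.tendsto_zero_of_dissipation (C := C * (V 0 / c + 1 + M)) (fun t ht => ?_) hVw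
      (fun t _ => hV0 t) (κ := 1 / 2) (by norm_num) fun t ht => by
        linarith [hwle t ht, hS t]
    refine (hh t ht).trans ?_
    gcongr
    · exact hξb t ht
    · exact hEb t ht
  -- The dissipation controls only `ε` and `T e`; `hKb` converts it into a multiple `1 / K` of the
  -- full squared error.
  · obtain ⟨B, hB⟩ := hfb i
    refine (he i).tendsto_zero_of_dissipation hB hVw (fun t _ => hV0 t) (κ := 1 / K)
      (by positivity) fun t ht => ?_
    have h1 : ‖e i t‖ ^ 2 ≤ ‖E t‖ ^ 2 := by
      gcongr
      exact norm_le_pi_norm (E t) i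
    have h2 : 1 / K * ‖e i t‖ ^ 2 ≤ ∑ i, ‖ε i t‖ ^ 2 + ∑ i, ‖T i (e i t)‖ ^ 2 := by
      rw [one_div, inv_mul_le_iff₀ hK]
      exact h1.trans (hKb (E t))
    nlinarith [hwle t ht, sq_nonneg ‖ξ t‖]

end Core

/-! ### Error dynamics of the observer network -/

namespace ObserverNode.IsDesigned

variable {n Nc : ℕ} {b : Fin Nc → ℕ} {o : ObserverNode n b} {A : Mat n n}

theorem transpose_orth (h : o.IsDesigned A) : o.Tu.transpose * o.Q.T = 0 := by
  simpa using congrArg Matrix.transpose h.orth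

/-- Polarized Pythagoras, from `T Tᵀ + Tu Tuᵀ = 1`. -/
theorem inner_split (h : o.IsDesigned A) (v w : Vec n) :
    (inner ℝ v w : ℝ) = inner ℝ (Mat.clm o.Q.T.transpose v) (Mat.clm o.Q.T.transpose w) +
      inner ℝ (Mat.clm o.Tu.transpose v) (Mat.clm o.Tu.transpose w) := by
  rw [Mat.clm_apply, Mat.clm_apply, Mat.clm_apply, Mat.clm_apply, Mat.inner_act, Mat.inner_act,
    Matrix.transpose_transpose, Matrix.transpose_transpose, ← Mat.mul_act, ← Mat.mul_act,
    ← inner_add_right, ← Mat.add_act, h.complement, add_sub_cancel, Mat.one_act]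

/-- `Tᵀ Tu = 0` removes the coupling, `B̄` the local input, `G C B₋ = Tᵀ B₋` the unavailable input,
and the Sylvester-type equation the dependence on `x`. -/
theorem act_T_transpose_dynamics (h : o.IsDesigned A) (x z : Vec n) (ul : Vec o.q)
    (un : Vec o.qneg) (v : Vec (n - o.δ)) {Bu : Vec n} (hBu : Bu = o.Bloc.act ul + o.Bneg.act un) :
    Mat.act o.Q.T.transpose ((o.Ebar A).act z + (o.Fbar A).act (o.C.act x) + o.Bbar.act ul
        - o.Tu.act v + o.Gbar.act (o.C.act (A.act x + Bu)) - (A.act x + Bu)) =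
      o.Q.E.act (Mat.act o.Q.T.transpose (z + o.Gbar.act (o.C.act x) - x)) := by
  obtain ⟨hTT, hB, hEq, -⟩ := h.mem
  have hE : o.Q.T.transpose * o.Ebar A = o.Q.E * o.Q.T.transpose := by
    rw [ObserverNode.Ebar, Matrix.mul_add, ← Matrix.mul_assoc, ← Matrix.mul_assoc,
      ← Matrix.mul_assoc, ← Matrix.mul_assoc, hTT, h.orth, Matrix.one_mul, Matrix.zero_mul,
      Matrix.zero_mul, add_zero]
  have hG : o.Q.T.transpose * o.Gbar = o.Q.G := by
    rw [ObserverNode.Gbar, ← Matrix.mul_assoc, hTT, Matrix.one_mul]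
  have hF : o.Q.T.transpose * o.Fbar A = o.Q.F := by
    rw [ObserverNode.Fbar, Matrix.mul_add, ← Matrix.mul_assoc, ← Matrix.mul_assoc,
      ← Matrix.mul_assoc, ← Matrix.mul_assoc, hTT, h.orth, Matrix.one_mul, Matrix.zero_mul,
      Matrix.zero_mul, Matrix.zero_mul, add_zero]
  have hBb : o.Q.T.transpose * o.Bbar = (o.Q.T.transpose - o.Q.G * o.C) * o.Bloc := by
    rw [ObserverNode.Bbar, ← Matrix.mul_assoc, Matrix.mul_sub, Matrix.mul_one, ← Matrix.mul_assoc,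
      hG]
  have h1 := congrArg (fun M => Mat.act M x) hEq
  have h2 := congrArg (fun M => Mat.act M un) hB
  simp only [Mat.add_act, Mat.sub_act, Mat.mul_act, Mat.zero_act] at h1 h2
  simp only [Mat.act_add, Mat.act_sub]
  rw [← Mat.mul_act o.Q.T.transpose, ← Mat.mul_act o.Q.T.transpose, ← Mat.mul_act o.Q.T.transpose,
    ← Mat.mul_act o.Q.T.transpose, ← Mat.mul_act o.Q.T.transpose o.Gbar,
    ← Mat.mul_act o.Q.T.transpose o.Gbar, ← Mat.mul_act o.Q.T.transpose o.Gbar, hE, hF, hBb, h.orth,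
    hG, hBu]
  simp only [Mat.sub_act, Mat.mul_act, Mat.zero_act, Mat.act_add]
  linear_combination (norm := module) h1 + h2

/-- `Tuᵀ Ḡ = 0` discards the output derivative, while `F̄` supplies the `A Ḡ y` needed to rebuild `A
x̂`. The input mismatch survives here and is left to the adaptive coupling. -/
theorem act_Tu_transpose_dynamics (h : o.IsDesigned A) (x z : Vec n) (ul : Vec o.q)
    (v : Vec (n - o.δ)) (Bu : Vec n) :
    Mat.act o.Tu.transpose ((o.Ebar A).act z + (o.Fbar A).act (o.C.act x) + o.Bbar.act ul
        - o.Tu.act v + o.Gbar.act (o.C.act (A.act x + Bu)) - (A.act x + Bu)) =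
      Mat.act o.Tu.transpose (A.act (z + o.Gbar.act (o.C.act x) - x) + (o.Bloc.act ul - Bu)) - v := by
  have h0 := h.transpose_orth
  have hE : o.Tu.transpose * o.Ebar A = o.Tu.transpose * A := by
    rw [ObserverNode.Ebar, Matrix.mul_add, ← Matrix.mul_assoc, ← Matrix.mul_assoc,
      ← Matrix.mul_assoc, ← Matrix.mul_assoc, h.orthonormal, h0, Matrix.one_mul, Matrix.zero_mul,
      Matrix.zero_mul, zero_add]
  have hG : o.Tu.transpose * o.Gbar = 0 := by
    rw [ObserverNode.Gbar, ← Matrix.mul_assoc, h0, Matrix.zero_mul]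
  have hF : o.Tu.transpose * o.Fbar A = o.Tu.transpose * A * o.Gbar := by
    rw [ObserverNode.Fbar, Matrix.mul_add, ← Matrix.mul_assoc, ← Matrix.mul_assoc,
      ← Matrix.mul_assoc, ← Matrix.mul_assoc, h.orthonormal, h0, Matrix.one_mul, Matrix.zero_mul,
      zero_add]
  have hBb : o.Tu.transpose * o.Bbar = o.Tu.transpose * o.Bloc := by
    rw [ObserverNode.Bbar, ← Matrix.mul_assoc, Matrix.mul_sub, Matrix.mul_one, ← Matrix.mul_assoc,
      hG, Matrix.zero_mul, sub_zero]
  simp only [Mat.act_add, Mat.act_sub]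
  rw [← Mat.mul_act o.Tu.transpose (o.Ebar A), ← Mat.mul_act o.Tu.transpose (o.Fbar A),
    ← Mat.mul_act o.Tu.transpose o.Bbar, ← Mat.mul_act o.Tu.transpose o.Tu,
    ← Mat.mul_act o.Tu.transpose o.Gbar, ← Mat.mul_act o.Tu.transpose o.Gbar, hE, hF, hBb,
    h.orthonormal, hG]
  simp only [Mat.mul_act, Mat.zero_act, Mat.one_act]
  module

end ObserverNode.IsDesigned

theorem exists_pos_le {N : ℕ} {c : Fin N → ℝ} (hc : ∀ i, 0 < c i) :
    ∃ c₀ : ℝ, 0 < c₀ ∧ ∀ i, c₀ ≤ c i := by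
  obtain ⟨M, hM⟩ := Finite.exists_le fun i => (c i)⁻¹
  refine ⟨(max M 1)⁻¹, by positivity, fun i => ?_⟩
  rw [inv_le_comm₀ (by positivity) (hc i)]
  exact (hM i).trans (le_max_left _ _)

/-- A stable linear system with bounded input has bounded trajectories. -/
theorem HasVelocity.bounded_of_lyapunov {n : ℕ} {x d : ℝ → Vec n}
    {E Q : Vec n →L[ℝ] Vec n} {c D : ℝ}
    (hx : HasVelocity x fun t => E (x t) + d t) (hd : ∀ t, 0 ≤ t → ‖d t‖ ≤ D) (hc : 0 < c)
    (hQs : ∀ u v, (Inner.inner ℝ (Q u) v : ℝ) = Inner.inner ℝ u (Q v))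
    (hQp : ∀ u, c * ‖u‖ ^ 2 ≤ Inner.inner ℝ (Q u) u)
    (hQE : ∀ u, 2 * Inner.inner ℝ (Q u) (E u) ≤ -‖u‖ ^ 2) : IsBoundedSignal x := by
  have hQn : ∀ u, (Inner.inner ℝ (Q u) u : ℝ) ≤ (‖Q‖ + 1) * ‖u‖ ^ 2 := fun u => by
    have h1 := real_inner_le_norm (Q u) u
    have h2 := mul_le_mul_of_nonneg_right (Q.le_opNorm u) (norm_nonneg u)
    nlinarith [sq_nonneg ‖u‖]
  -- Half of `-‖x‖²` pays for the input, leaving `2 (‖Q‖ D)²`; the other half dominates the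
  -- quadratic form, which is at most `(‖Q‖ + 1) ‖x‖²`.
  obtain ⟨M, hM⟩ := (hx.quadratic Q hQs).bounded_above_of_decay (l := 1 / (2 * (‖Q‖ + 1)))
    (c := 2 * (‖Q‖ * D) ^ 2) (by positivity) fun t ht => by
      rw [inner_add_right]
      have h1 := hQE (x t)
      have h2 : (Inner.inner ℝ (Q (x t)) (d t) : ℝ) ≤ (‖Q‖ * ‖x t‖) * D :=
        (real_inner_le_norm _ _).trans
          (mul_le_mul (Q.le_opNorm _) (hd t ht) (norm_nonneg _) (by positivity))
      have h3 : 1 / (2 * (‖Q‖ + 1)) * (Inner.inner ℝ (Q (x t)) (x t) : ℝ) ≤ ‖x t‖ ^ 2 / 2 := by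
        rw [one_div, inv_mul_le_iff₀ (by positivity)]
        linarith [hQn (x t)]
      nlinarith [sq_nonneg (‖x t‖ - 2 * (‖Q‖ * D))]
  refine ⟨|M| / c + 1, fun t ht => ?_⟩
  have h1 : ‖x t‖ ^ 2 ≤ |M| / c := by
    rw [le_div_iff₀ hc]
    linarith [hQp (x t), hM t ht, le_abs_self M]
  nlinarith [norm_nonneg (x t)]

/-! ### Tracking error, estimation errors and input mismatch in the closed loop -/

section ClosedLoop

variable {n m Nc N : ℕ} {D : Setting n m Nc N}

/-- Such a `v` is orthogonal to every `Im T_id`, hence to their sum, hence to itself. -/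
theorem Setting.IsCollectivelyDetectable.eq_zero (hdet : D.IsCollectivelyDetectable) {v : Vec n}
    (h : ∀ i, Mat.clm (D.obs i).Q.T.transpose v = 0) : v = 0 := by
  have hle : ⨆ i, LinearMap.range (Matrix.mulVecLin (D.obs i).Q.T) ≤
      LinearMap.ker (dotProductBilin ℝ ℝ v.ofLp) := by
    refine iSup_le fun i => ?_
    rintro _ ⟨w, rfl⟩
    have h1 : Matrix.mulVec (D.obs i).Q.T.transpose v.ofLp = 0 := congrArg WithLp.ofLp (h i)
    change v.ofLp ⬝ᵥ Matrix.mulVec (D.obs i).Q.T w = 0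
    rw [Matrix.dotProduct_mulVec, ← Matrix.mulVec_transpose, h1, zero_dotProduct]
  rw [hdet] at hle
  have h1 : v.ofLp ⬝ᵥ v.ofLp = 0 := hle (Submodule.mem_top (x := v.ofLp))
  have h2 := dotProduct_self_eq_zero.1 h1
  ext j
  exact congrFun h2 j

/-- The closed-loop matrix `A + ∑ ι, B^ι K^ι` as a continuous linear map. -/
noncomputable def Setting.closedLoop (D : Setting n m Nc N) : Vec n →L[ℝ] Vec n :=
  D.P.A.clm + ∑ ι, ((D.P.Bc ι).clm).comp (D.K ι).clm

theorem Setting.closedLoop_apply (D : Setting n m Nc N) (x : Vec n) :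
    D.closedLoop x = D.P.A.act x + ∑ ι, (D.P.Bc ι).act ((D.K ι).act x) := by
  simp [Setting.closedLoop]

theorem Setting.exists_closedLoop_lyapunov (hK : D.P.IsStabilizedBy D.K) :
    ∃ Q : Vec n →L[ℝ] Vec n, ∃ c : ℝ, 0 < c ∧
      (∀ u v, (inner ℝ (Q u) v : ℝ) = inner ℝ u (Q v)) ∧
      (∀ x, c * ‖x‖ ^ 2 ≤ inner ℝ (Q x) x) ∧
      ∀ x, 2 * inner ℝ (Q x) (D.closedLoop x) ≤ -‖x‖ ^ 2 := by
  obtain ⟨T, hT, hE⟩ := exists_exp_small_of_tendsto D.closedLoop fun x hx => hK x <|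
    hx.congr (fun _ _ => rfl) fun t _ => (D.closedLoop_apply (x t)).symm
  exact exists_lyapunov _ hT hE

/-- The reference system is stable with bounded input. This makes the controls bounded up to terms
linear in the errors. -/
theorem Setting.IsReference.isBoundedSignal (hK : D.P.IsStabilizedBy D.K)
    (hr : ∀ ι, IsBoundedSignal (D.r ι)) {xr : ℝ → Vec n} (hxr : D.IsReference xr) :
    IsBoundedSignal xr := by
  obtain ⟨Q, c, hc, hQs, hQp, hQE⟩ := Setting.exists_closedLoop_lyapunov hK
  choose R hR using hr
  have h1 : HasVelocity xr fun t => D.closedLoop (xr t) + ∑ ι, (D.P.Bc ι).act (D.r ι t) := by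
    refine HasVelocity.congr hxr (fun _ _ => rfl) fun t _ => ?_
    simp only [D.closedLoop_apply, Mat.act_add, Finset.sum_add_distrib]
    abel
  refine h1.bounded_of_lyapunov (D := ∑ ι, ‖(D.P.Bc ι).clm‖ * R ι) (fun t ht => ?_) hc hQs hQp hQE
  refine (norm_sum_le _ _).trans (Finset.sum_le_sum fun ι _ => ?_)
  exact ((D.P.Bc ι).clm.le_opNorm _).trans (by gcongr; exact hR ι t ht)

namespace Signals

/-- The velocity of the estimation error `x̂_i - x`. -/
noncomputable def errVel (s : Signals D) (i : Fin N) (t : ℝ) : Vec n :=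
  ((D.obs i).Ebar D.P.A).act (s.z i t) + ((D.obs i).Fbar D.P.A).act (s.y i t)
    + (D.obs i).Bbar.act (s.uloc i t) - s.H i t
    + (D.obs i).Gbar.act ((D.obs i).C.act (D.P.A.act (s.x t) + D.P.B.act (s.u t)))
    - (D.P.A.act (s.x t) + D.P.B.act (s.u t))

variable {s : Signals D}

theorem H_eq (i : Fin N) (t : ℝ) :
    s.H i t = (D.obs i).Tu.act (s.γ i t • s.εu i t + s.γs i t • s.η i t) := by
  simp only [Signals.H, Mat.act_add, Mat.act_smul]

/-- The plant state cancels in differences of estimates, so the coupling acts on the errors. -/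
theorem εu_eq (i : Fin N) (t : ℝ) : s.εu i t =
    Mat.clm (D.obs i).Tu.transpose (graphLap D.a (fun j => s.xhat j t - s.x t) i) := by
  simp only [Signals.εu, graphLap, sub_sub_sub_cancel_right, Mat.clm_apply]

namespace IsClosedLoop

theorem hasVelocity_error (hs : s.IsClosedLoop) (i : Fin N) :
    HasVelocity (fun t => s.xhat i t - s.x t) (s.errVel i) :=
  ((hs.observer i).add ((hs.plant.clm (D.obs i).C.clm).clm (D.obs i).Gbar.clm)).sub hs.plant

theorem T_errVel (hs : s.IsClosedLoop) {i : Fin N} (ho : (D.obs i).IsDesigned D.P.A) {t : ℝ}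
    (ht : 0 ≤ t) : Mat.clm (D.obs i).Q.T.transpose (s.errVel i t) =
      Mat.clm (D.obs i).Q.E (Mat.clm (D.obs i).Q.T.transpose (s.xhat i t - s.x t)) := by
  rw [errVel, H_eq]
  exact ho.act_T_transpose_dynamics (s.x t) (s.z i t) (s.uloc i t) (s.uneg i t) _ (hs.split i t ht)

theorem Tu_errVel {i : Fin N} (ho : (D.obs i).IsDesigned D.P.A) (t : ℝ) :
    Mat.clm (D.obs i).Tu.transpose (s.errVel i t) =
      Mat.clm (D.obs i).Tu.transpose (D.P.A.act (s.xhat i t - s.x t) +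
        ((D.obs i).Bloc.act (s.uloc i t) - D.P.B.act (s.u t)))
      - s.γ i t • s.εu i t - s.γs i t • s.η i t := by
  rw [errVel, H_eq, sub_sub]
  exact ho.act_Tu_transpose_dynamics (s.x t) (s.z i t) (s.uloc i t) _ _

/-- This component is constant when `E = 0`, and by `z_i(0) = 0` its initial value is `(G C - Tᵀ)
x(0) = 0`. -/
theorem T_error_eq_zero (hs : s.IsClosedLoop) {i : Fin N} (ho : (D.obs i).IsDesigned D.P.A)
    (hE : (D.obs i).Q.E = 0) {t : ℝ} (ht : 0 ≤ t) :
    Mat.clm (D.obs i).Q.T.transpose (s.xhat i t - s.x t) = 0 := by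
  have h1 := ((hs.hasVelocity_error i).clm (Mat.clm (D.obs i).Q.T.transpose)).congr
    (g := fun _ => 0) (fun _ _ => rfl) fun t ht => by
      rw [hs.T_errVel ho ht, hE, Mat.clm_apply, Mat.zero_act]
  have h2 := (h1 t ht).2
  rw [intervalIntegral.integral_zero, add_zero] at h2
  refine h2.trans ?_
  beta_reduce
  rw [Mat.clm_apply, Signals.xhat, Signals.y, hs.z_init, zero_add, Mat.act_sub, ← Mat.mul_act,
    ← Mat.mul_act, ObserverNode.Gbar, ← Matrix.mul_assoc, ho.mem.1,
    Matrix.one_mul, ho.zero_case hE, sub_self]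

/-- The decay inequality is claimed only along the trajectory: for `E = 0` it can fail for general
vectors, but the actual component vanishes and any positive form serves. -/
theorem exists_node_lyapunov (hs : s.IsClosedLoop) {i : Fin N}
    (ho : (D.obs i).IsDesigned D.P.A) :
    ∃ Q : Vec (D.obs i).δ →L[ℝ] Vec (D.obs i).δ, ∃ c : ℝ, 0 < c ∧
      (∀ u v, (inner ℝ (Q u) v : ℝ) = inner ℝ u (Q v)) ∧
      (∀ x, c * ‖x‖ ^ 2 ≤ inner ℝ (Q x) x) ∧
      ∀ t, 0 ≤ t → 2 * inner ℝ (Q (Mat.clm (D.obs i).Q.T.transpose (s.xhat i t - s.x t)))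
        (Mat.clm (D.obs i).Q.T.transpose (s.errVel i t)) ≤
        -‖Mat.clm (D.obs i).Q.T.transpose (s.xhat i t - s.x t)‖ ^ 2 := by
  rcases ho.mem.2.2.2 with hE | ⟨-, hE⟩
  · obtain ⟨T, hT, hexp⟩ := hE.exists_exp_small
    obtain ⟨Q, c, hc, h1, h2, h3⟩ := exists_lyapunov _ hT hexp
    refine ⟨Q, c, hc, h1, h2, fun t ht => ?_⟩
    rw [hs.T_errVel ho ht]
    exact h3 _
  · refine ⟨.id ℝ _, 1, one_pos, fun _ _ => rfl, fun x => ?_, fun t ht => ?_⟩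
    · simp
    · rw [hs.T_error_eq_zero ho hE ht]
      simp

/-- The references cancel, and `x̂ - x_r = (x - x_r) + (x̂ - x)` separates feedback from
perturbation. -/
theorem tracking_velocity (hs : s.IsClosedLoop) (xr : ℝ → Vec n) {t : ℝ} (ht : 0 ≤ t) :
    D.P.A.act (s.x t) + D.P.B.act (s.u t) -
      (D.P.A.act (xr t) + ∑ ι, (D.P.Bc ι).act ((D.K ι).act (xr t) + D.r ι t)) =
    D.closedLoop (s.x t - xr t) +
      ∑ ι, (D.P.Bc ι).act ((D.K ι).act (s.xhat (D.src ι) t - s.x t)) := by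
  rw [hs.channels t ht, D.closedLoop_apply]
  simp only [Signals.uc, Mat.act_add, Mat.act_sub, Finset.sum_add_distrib, Finset.sum_sub_distrib]
  abel

/-- The mismatch is linear in the controls, which are affine in `x̂ = (x̂ - x) + (x - x_r) + x_r`
with `x_r` and the references bounded. The part depending on the errors calls for `γ_i`, the
constant part for `γ_is`. -/
theorem exists_input_bound (hs : s.IsClosedLoop) (hr : ∀ ι, IsBoundedSignal (D.r ι))
    {xr : ℝ → Vec n} (hxr : IsBoundedSignal xr) (i : Fin N) :
    ∃ C R : ℝ, ∀ t, 0 ≤ t → ‖Mat.clm (D.obs i).Tu.transpose (D.P.A.act (s.xhat i t - s.x t) +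
        ((D.obs i).Bloc.act (s.uloc i t) - D.P.B.act (s.u t)))‖ ≤
      C * (‖s.x t - xr t‖ + ‖fun j => s.xhat j t - s.x t‖) + R := by
  choose R hR using hr
  obtain ⟨Rx, hRx⟩ := hxr
  set L : ∀ ι, Vec (D.P.b ι) →L[ℝ] Vec n := fun ι =>
    (D.obs i).Bloc.clm.comp ((D.obs i).S ι).clm - (D.P.Bc ι).clm with hL
  set U := Mat.clm (D.obs i).Tu.transpose
  refine ⟨‖U‖ * (‖D.P.A.clm‖ + ∑ ι, ‖L ι‖ * ‖(D.K ι).clm‖),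
    ‖U‖ * ∑ ι, ‖L ι‖ * (‖(D.K ι).clm‖ * Rx + R ι), fun t ht => ?_⟩
  set X := ‖s.x t - xr t‖
  set Y := ‖fun j => s.xhat j t - s.x t‖
  have hX : 0 ≤ X := norm_nonneg _
  have hY : ∀ j, ‖s.xhat j t - s.x t‖ ≤ Y := fun j =>
    norm_le_pi_norm (fun j => s.xhat j t - s.x t) j
  have hu : ∀ ι, ‖s.uc ι t‖ ≤ ‖(D.K ι).clm‖ * (X + Y) + (‖(D.K ι).clm‖ * Rx + R ι) := fun ι => by
    have h1 : ‖s.xhat (D.src ι) t‖ ≤ X + Y + Rx := by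
      have : s.xhat (D.src ι) t = (s.xhat (D.src ι) t - s.x t) + (s.x t - xr t) + xr t := by abel
      rw [this]
      have h2 := norm_add₃_le (a := s.xhat (D.src ι) t - s.x t) (b := s.x t - xr t) (c := xr t)
      linarith [hY (D.src ι), hRx t ht]
    have h2 : ‖(D.K ι).act (s.xhat (D.src ι) t)‖ ≤ ‖(D.K ι).clm‖ * (X + Y + Rx) :=
      ((D.K ι).clm.le_opNorm _).trans (by gcongr)
    have h3 : ‖s.uc ι t‖ ≤ ‖(D.K ι).act (s.xhat (D.src ι) t)‖ + ‖D.r ι t‖ := norm_add_le _ _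
    linarith [hR ι t ht]
  have h1 : (D.obs i).Bloc.act (s.uloc i t) - D.P.B.act (s.u t) = ∑ ι, L ι (s.uc ι t) := by
    rw [hs.channels t ht, Signals.uloc, ← Mat.clm_apply, map_sum, ← Finset.sum_sub_distrib]
    rfl
  have h2 : ‖∑ ι, L ι (s.uc ι t)‖ ≤ (∑ ι, ‖L ι‖ * ‖(D.K ι).clm‖) * (X + Y) +
      ∑ ι, ‖L ι‖ * (‖(D.K ι).clm‖ * Rx + R ι) := by
    refine (norm_sum_le _ _).trans ?_
    rw [Finset.sum_mul, ← Finset.sum_add_distrib]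
    refine Finset.sum_le_sum fun ι _ => ((L ι).le_opNorm _).trans ?_
    have := mul_le_mul_of_nonneg_left (hu ι) (norm_nonneg (L ι))
    linarith
  have h3 : ‖D.P.A.act (s.xhat i t - s.x t)‖ ≤ ‖D.P.A.clm‖ * (X + Y) :=
    (D.P.A.clm.le_opNorm _).trans (by gcongr; linarith [hY i])
  rw [h1]
  calc _ ≤ ‖U‖ * ‖D.P.A.act (s.xhat i t - s.x t) + ∑ ι, L ι (s.uc ι t)‖ := U.le_opNorm _
    _ ≤ ‖U‖ * (‖D.P.A.clm‖ * (X + Y) + ((∑ ι, ‖L ι‖ * ‖(D.K ι).clm‖) * (X + Y) +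
      ∑ ι, ‖L ι‖ * (‖(D.K ι).clm‖ * Rx + R ι))) := by
        gcongr
        exact (norm_add_le _ _).trans (add_le_add h3 h2)
    _ = _ := by ring

end IsClosedLoop

end Signals

end ClosedLoop

/-! ### Assembly of the closed-loop convergence result -/

theorem theorem4 {n m Nc N : ℕ} (D : Setting n m Nc N)
    (hAB : IsStabilizable D.P.A D.P.B)
    (hK : D.P.IsStabilizedBy D.K)
    (hr : ∀ ι, IsBoundedSignal (D.r ι))
    (𝒢 : SimpleGraph (Fin N)) (ha : IsWeightedAdjacency 𝒢 D.a) (hG : 𝒢.Connected)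
    (hobs : ∀ i, (D.obs i).IsDesigned D.P.A)
    (hdet : D.IsCollectivelyDetectable)
    (s : Signals D) (hs : s.IsClosedLoop)
    (xr : ℝ → Vec n) (hxr : D.IsReference xr) :
    Tendsto (fun t => ‖s.x t - xr t‖) atTop (𝓝 0) ∧
    (∀ i, Tendsto (fun t => ‖s.xhat i t - s.x t‖) atTop (𝓝 0)) ∧
    (∀ i, IsBoundedSignal (s.γ i) ∧ IsBoundedSignal (s.γs i)) := by
  obtain ⟨Q, c₁, hc₁, hQs, hQp, hQE⟩ := Setting.exists_closedLoop_lyapunov hK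
  choose Qd c₂ hc₂ hQds hQdp hQde using fun i => hs.exists_node_lyapunov (hobs i)
  obtain ⟨c₃, hc₃, hc₃le⟩ := exists_pos_le hc₂
  choose C₁ R₁ hρ using hs.exists_input_bound hr (Setting.IsReference.isBoundedSignal hK hr hxr)
  obtain ⟨C₂, hC₂⟩ := Finite.exists_le C₁
  obtain ⟨R, hR⟩ := Finite.exists_le R₁
  obtain ⟨C₃, hC₃⟩ := Finite.exists_le fun i => ‖Mat.clm (D.obs i).Q.E‖
  obtain ⟨C₄, hC₄, hlap⟩ := exists_norm_graphLap_le (n := n) D.a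
  obtain ⟨B₀, hB₀⟩ : ∃ B₀, B₀ = ∑ ι, ‖(D.P.Bc ι).clm‖ * ‖(D.K ι).clm‖ := ⟨_, rfl⟩
  have hB₀0 : 0 ≤ B₀ := by rw [hB₀]; positivity
  -- One constant for all growth estimates of the abstract stability result; the last entry bounds
  -- the cross term of the Lyapunov form of `ξ` with the estimation errors.
  obtain ⟨C, hCle⟩ : ∃ C, |C₂| ≤ C ∧ |C₃| ≤ C ∧ C₄ ≤ C ∧ ‖D.closedLoop‖ ≤ C ∧ B₀ ≤ C ∧
      2 * ‖Q‖ * B₀ ≤ C := by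
    obtain ⟨C, hC⟩ := Finite.exists_le
      ![|C₂|, |C₃|, C₄, ‖D.closedLoop‖, B₀, 2 * ‖Q‖ * B₀]
    exact ⟨C, hC 0, hC 1, hC 2, hC 3, hC 4, hC 5⟩
  obtain ⟨hCC₂, hCC₃, hCC₄, hCcl, hCB, hCQ⟩ := hCle
  have hC0 : 0 ≤ C := hC₄.trans hCC₄
  have hg : ∀ t, ‖∑ ι, (D.P.Bc ι).act ((D.K ι).act (s.xhat (D.src ι) t - s.x t))‖ ≤
      B₀ * ‖fun j => s.xhat j t - s.x t‖ := fun t => by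
    rw [hB₀, Finset.sum_mul]
    refine (norm_sum_le _ _).trans (Finset.sum_le_sum fun ι _ => ?_)
    refine ((D.P.Bc ι).clm.le_opNorm _).trans ?_
    rw [mul_assoc]
    refine mul_le_mul_of_nonneg_left (((D.K ι).clm.le_opNorm _).trans ?_) (norm_nonneg _)
    exact mul_le_mul_of_nonneg_left (norm_le_pi_norm (fun j => s.xhat j t - s.x t) (D.src ι))
      (norm_nonneg _)
  refine tendsto_zero_of_adaptive_coupling (T := fun i => Mat.clm (D.obs i).Q.T.transpose)
    (U := fun i => Mat.clm (D.obs i).Tu.transpose) ha hG (fun i => (hobs i).inner_split)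
    (fun v hv => hdet.eq_zero hv) (f := s.errVel) (Qd := Qd) (Q := Q) (C := C) (D := R)
    (c := min c₁ c₃) (φ := fun i => (D.obs i).φ) (φs := fun i => (D.obs i).φs) (η := s.η)
    (ρ := fun i t => Mat.clm (D.obs i).Tu.transpose (D.P.A.act (s.xhat i t - s.x t) +
      ((D.obs i).Bloc.act (s.uloc i t) - D.P.B.act (s.u t)))) hC0
    (lt_min hc₁ hc₃) (fun i => (hobs i).φ_pos) (fun i => (hobs i).φs_pos) hs.hasVelocity_error
    (hs.plant.sub hxr) (fun i => ?_) (fun i => ?_) hQs (fun u => ?_) (fun t ht => ?_)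
    (fun t ht => ?_) hQds (fun i u => ?_) hQde (fun i t ht => ?_)
    (fun i t ht => (Signals.IsClosedLoop.Tu_errVel (hobs i) t).trans ?_) (fun i t ht => ?_)
    (fun i t ht => ?_) fun x i => ?_
  · exact (hs.adapt i).congr (fun _ _ => rfl) fun t _ => by rw [s.εu_eq]
  · exact (hs.adapts i).congr (fun _ _ => rfl) fun t _ => by rw [s.εu_eq]
  · exact (mul_le_mul_of_nonneg_right (min_le_left _ _) (sq_nonneg _)).trans (hQp u)
  · rw [hs.tracking_velocity xr ht, inner_add_right, mul_add]
    refine add_le_add (hQE _) ?_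
    refine (mul_le_mul_of_nonneg_left ((real_inner_le_norm _ _).trans
      (mul_le_mul (Q.le_opNorm _) (hg t) (norm_nonneg _) (by positivity))) zero_le_two).trans ?_
    calc _ = 2 * ‖Q‖ * B₀ * (‖s.x t - xr t‖ * ‖fun j => s.xhat j t - s.x t‖) := by ring
      _ ≤ C * (‖s.x t - xr t‖ * ‖fun j => s.xhat j t - s.x t‖) := by gcongr
      _ = _ := by ring
  · rw [hs.tracking_velocity xr ht, mul_add]
    refine (norm_add_le _ _).trans (add_le_add ((D.closedLoop.le_opNorm _).trans ?_)
      ((hg t).trans ?_)) <;> gcongr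
  · exact (mul_le_mul_of_nonneg_right ((min_le_right _ _).trans (hc₃le i)) (sq_nonneg _)).trans
      (hQdp i u)
  · rw [hs.T_errVel (hobs i) ht]
    refine ((Mat.clm (D.obs i).Q.E).le_opNorm _).trans ?_
    gcongr
    exact (hC₃ i).trans ((le_abs_self _).trans hCC₃)
  · rw [s.εu_eq]
  · refine (hρ i t ht).trans ?_
    gcongr
    · exact (hC₂ i).trans ((le_abs_self _).trans hCC₂)
    · exact hR i
  · have := hs.selection i t ht
    rwa [s.εu_eq] at this
  · exact (hlap x i).trans (by gcongr)
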